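/- Let $N\ge 1$ be an integer. Let $C_{\mathrm{sp}}(N)\le \operatorname{GL}_2(\mathbb Z/N\mathbb Z)$ be the split Cartan subgroup, i.e. the group of invertible diagonal matrices, and let $C_{\mathrm{sp}}^*(N)$ be the subgroup of $\operatorname{GL}_2(\mathbb Z/N\mathbb Z)$ generated by $C_{\mathrm{sp}}(N)$ together with, for each prime $p\mid N$, the matrix $w_p$ with $w_p\equiv \begin{pmatrix}0&1\\1&0\end{pmatrix} \pmod{p^{\nu_p(N)}}$ and $w_p\equiv I \pmod{N/p^{\nu_p(N)}}$, where $\nu_p$ is the $p$-adic valuation. Let $X_{\mathrm{sp}}^*(N)$ be the associated modular curve and put $\Gamma = C_{\mathrm{sp}}^*(N)\cap \operatorname{SL}_2(\mathbb Z/N\mathbb Z)$. Let $\varepsilon_2^*$ and $\varepsilon_3^*$ be the numbers of elliptic points of order $2$ and $3$ on $X_{\mathrm{sp}}^*(N)$, i.e. the numbers of right cosets in $\Gamma\backslash \operatorname{SL}_2(\mathbb Z/N\mathbb Z)$ fixed under right multiplication by $\begin{pmatrix}0&-1\\1&0\end{pmatrix}$ and by $\begin{pmatrix}0&-1\\1&-1\end{pmatrix}$,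 respectively, and let $\varepsilon_\infty^*$ be its number of cusps, i.e. the number of orbits of $\Gamma\backslash \operatorname{SL}_2(\mathbb Z/N\mathbb Z)$ under right multiplication by the group generated by $\begin{pmatrix}1&1\\0&1\end{pmatrix}$. Let $\omega(N)$ be the number of distinct primes dividing $N$; all products are over primes. Then \begin{align*} \varepsilon_\infty^* &= \begin{cases} \dfrac{N}{3\cdot 2^{\omega(N)-2}}\displaystyle\prod_{p\mid N}\left(1+\frac1p\right) & \text{if } 2\mid N \text{ and } 4\nmid N,\\[2mm] \dfrac{N}{2^{\omega(N)}}\displaystyle\prod_{p\mid N}\left(1+\frac1p\right) & \text{otherwise,}\end{cases}\\ \varepsilon_3^* &= \begin{cases} 1 & \text{if } p\equiv 1\pmod 3 \text{ for all } p\mid N,\\ 0 & \text{otherwise,}\end{cases}\\ \varepsilon_2^* &= c(N)\cdot \prod_{\substack{p\mid N\\ p\equiv 1 \bmod 4}}\left(1+\frac{p^{\nu_p(N)-1}(p-1)}{2}\right)\cdot \prod_{\substack{p\mid N\\ p\equiv 3\bmod 4}} \frac{p^{\nu_p(N)-1}(p+1)}{2}, \end{align*} where $c(N)=2^{\nu_2(N)-1}$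 if $2\mid N$ and $c(N)=1$ if $N$ is odd. -/

import Mathlib

open scoped Pointwise MatrixGroups

namespace SplitCartan

/-- The split Cartan subgroup `C_sp(N)`: the invertible diagonal matrices over `ℤ/Nℤ`. -/
def cartan (N : ℕ) : Subgroup (GL (Fin 2) (ZMod N)) where
  carrier := {g | g.1 0 1 = 0 ∧ g.1 1 0 = 0}
  one_mem' := by simp
  mul_mem' := by
    rintro a b ⟨ha, ha'⟩ ⟨hb, hb'⟩
    simp [Matrix.mul_apply, Fin.sum_univ_two, ha, ha', hb, hb']
  inv_mem' := by
    rintro a ⟨ha, ha'⟩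
    simp [Matrix.inv_def, Matrix.adjugate_fin_two, ha, ha']

/-- The canonical involution `(0 1; 1 0)` of the split Cartan subgroup, over a ring `R`. -/
def swap (R : Type*) [CommRing R] : GL (Fin 2) R where
  val := !![0, 1; 1, 0]
  inv := !![0, 1; 1, 0]
  val_inv := by simp [Matrix.one_fin_two]
  inv_val := by simp [Matrix.one_fin_two]

/-- `w` is the involution at the prime `p`: it is congruent to `(0 1; 1 0)` modulo the exact
power `ordProj[p] N` of `p` dividing `N`, and to the identity modulo the prime-to-`p` part
`ordCompl[p] N` of `N`. -/
def IsInvolutionAt (N p : ℕ) (w : GL (Fin 2) (ZMod N)) : Prop :=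
  Matrix.GeneralLinearGroup.map (ZMod.castHom (Nat.ordProj_dvd N p) (ZMod (ordProj[p] N))) w =
      swap (ZMod (ordProj[p] N)) ∧
    Matrix.GeneralLinearGroup.map
      (ZMod.castHom (Nat.ordCompl_dvd N p) (ZMod (ordCompl[p] N))) w = 1

/-- The group `C_sp^*(N)`, generated by the split Cartan subgroup and one involution for each
prime dividing `N`. -/
def cartanStar (N : ℕ) : Subgroup (GL (Fin 2) (ZMod N)) :=
  Subgroup.closure
    ((cartan N : Set (GL (Fin 2) (ZMod N))) ∪ {w | ∃ p ∈ N.primeFactors, IsInvolutionAt N p w})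

/-- `H ∩ SL₂(ℤ/Nℤ)`, as a subgroup of `SL₂(ℤ/Nℤ)`: the image of `Γ_H ≤ SL₂(ℤ)`, the lift of
`H ∩ SL₂(ℤ/Nℤ)`. -/
def slPart {N : ℕ} (H : Subgroup (GL (Fin 2) (ZMod N))) : Subgroup SL(2, ZMod N) :=
  H.comap Matrix.SpecialLinearGroup.toGL

/-- The right cosets `Γ g` of `Γ` in a group `G`, as subsets of `G`. -/
def rightCosets {G : Type*} [Group G] (Γ : Subgroup G) : Set (Set G) :=
  Set.range fun g : G => MulOpposite.op g • (Γ : Set G)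

/-- The number of right cosets `C` of `Γ` that are fixed by the right action of `x`, that is,
`C x = C`. -/
noncomputable def fixedCosets {G : Type*} [Group G] (Γ : Subgroup G) (x : G) : ℕ :=
  {C ∈ rightCosets Γ | MulOpposite.op x • C = C}.ncard

/-- The number of orbits of the right action of (the cyclic group generated by) `x` on the right
cosets of `Γ`. -/
noncomputable def cosetOrbits {G : Type*} [Group G] (Γ : Subgroup G) (x : G) : ℕ :=
  ((fun C : Set G => MulAction.orbit (Subgroup.zpowers (MulOpposite.op x)) C) ''
    rightCosets Γ).ncard

/-- The number of elliptic points of order `2` on the modular curve `X_H`. -/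
noncomputable def ellipticTwo {N : ℕ} (H : Subgroup (GL (Fin 2) (ZMod N))) : ℕ :=
  fixedCosets (slPart H) ⟨!![0, -1; 1, 0], by simp [Matrix.det_fin_two]⟩

/-- The number of elliptic points of order `3` on the modular curve `X_H`. -/
noncomputable def ellipticThree {N : ℕ} (H : Subgroup (GL (Fin 2) (ZMod N))) : ℕ :=
  fixedCosets (slPart H) ⟨!![0, -1; 1, -1], by simp [Matrix.det_fin_two]⟩

/-- The number of cusps on the modular curve `X_H`. -/
noncomputable def cusps {N : ℕ} (H : Subgroup (GL (Fin 2) (ZMod N))) : ℕ :=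
  cosetOrbits (slPart H) ⟨!![1, 1; 0, 1], by simp [Matrix.det_fin_two]⟩

end SplitCartan

/-! The group `cartanStar N` is cut out by equations: it consists of the invertible matrices with
rows (a, b), (c, d) such that ab = 0 and cd = 0 (`cartanStar_eq_monomial`). Over a local ring this
means diagonal or antidiagonal, and the condition is compatible with the Chinese remainder theorem.

A coset Γg is fixed by x exactly when g x g⁻¹ ∈ Γ, so the number of fixed cosets is #{g : g x g⁻¹ ∈
Γ} / #Γ (`card_conj_mem`). For x coming from SL₂(ℤ) both counts are multiplicative in N, which
reduces the elliptic points to N = p^k (`fixedCosets_eq_prod`). There g x g⁻¹ is diagonal when the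
rows of g are isotropic for X² + tXY + Y². Such g correspond to pairs of a unit and a simple root of
r² + tr + 1 (`card_isotropic_rows`), and the roots are found modulo p and lifted by Hensel. For
order 3 (t = 1) nothing else occurs. For order 2 (t = 0) the conjugate may also be antidiagonal,
which means that the rows of g are orthogonal (`card_orthogonal_rows`).

The cusps are counted by Burnside's lemma for the cyclic group of order N generated by T
(`cosetOrbits_mul`). A monomial conjugate of T^k forces 2k = 0 in ℤ/N, and k = 0 when also k² = 0
(`IsMono.conj_T_pow`). Hence only k = 0 contributes, except when N = 2m with m odd: then k = m adds
a third of the main term, whence the factor 4/3. -/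

namespace SplitCartan

/-! ### Fixed cosets and coset orbits in a finite group -/

section Cosets

variable {G : Type*} [Group G]

theorem op_smul_op_smul_eq_iff (Γ : Subgroup G) (x g : G) :
    MulOpposite.op x • MulOpposite.op g • (Γ : Set G) = MulOpposite.op g • (Γ : Set G) ↔
      g * x * g⁻¹ ∈ Γ := by
  rw [smul_smul, ← MulOpposite.op_mul, rightCoset_eq_iff, ← Γ.inv_mem_iff]
  simp [mul_assoc]

/-- Counting the conjugates of `x` in `Γ` by the right coset of the conjugating element. -/
theorem card_conj_mem [Finite G] (Γ : Subgroup G) (x : G) :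
    Nat.card {g : G // g * x * g⁻¹ ∈ Γ} = fixedCosets Γ x * Nat.card Γ := by
  classical
  have := Fintype.ofFinite G
  set F : Set (Set G) := {C ∈ rightCosets Γ | MulOpposite.op x • C = C} with hF
  -- Whether g x g⁻¹ lies in Γ depends only on Γg, so the fibre over a fixed coset C is all of C.
  have hfib : ∀ C ∈ F.toFinset,
      (Finset.univ.filter fun g : G => g * x * g⁻¹ ∈ Γ ∧ MulOpposite.op g • (Γ : Set G) = C).card =
        Nat.card Γ := by
    intro C hC
    rw [Set.mem_toFinset] at hC
    obtain ⟨⟨g₀, rfl⟩, hfix⟩ := hC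
    rw [op_smul_op_smul_eq_iff] at hfix
    rw [Nat.card_eq_fintype_card, Fintype.card_subtype]
    symm
    refine Finset.card_bij (fun h _ => h * g₀) ?_ ?_ ?_
    · intro h hh
      simp only [Finset.mem_filter, Finset.mem_univ, true_and] at hh ⊢
      constructor
      · have := Γ.mul_mem (Γ.mul_mem hh hfix) (Γ.inv_mem hh)
        simpa [mul_assoc] using this
      · rw [rightCoset_eq_iff]
        simpa using hh
    · intro a _ b _ hab
      exact mul_right_cancel hab
    · intro g hg
      simp only [Finset.mem_filter, Finset.mem_univ, true_and] at hg
      refine ⟨g * g₀⁻¹, ?_, by simp⟩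
      simp only [Finset.mem_filter, Finset.mem_univ, true_and]
      exact (rightCoset_eq_iff Γ).1 hg.2.symm
  have hmaps : Set.MapsTo (fun g : G => MulOpposite.op g • (Γ : Set G))
      ((Finset.univ.filter fun g : G => g * x * g⁻¹ ∈ Γ : Finset G) : Set G) F.toFinset := by
    intro g hg
    simp only [Finset.coe_filter, Finset.mem_univ, true_and, Set.mem_ofPred_eq] at hg
    simp only [Set.coe_toFinset, hF, Set.mem_ofPred_eq]
    exact ⟨⟨g, rfl⟩, (op_smul_op_smul_eq_iff Γ x g).2 hg⟩
  rw [Nat.card_eq_fintype_card, Fintype.card_subtype, Finset.card_eq_sum_card_fiberwise hmaps]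
  simp only [Finset.filter_filter]
  rw [Finset.sum_congr rfl hfib, Finset.sum_const, smul_eq_mul, fixedCosets,
    Set.ncard_eq_toFinset_card']

/-- The right cosets of `Γ`, with the right action of the cyclic group generated by `x`. -/
def rightCosetsAction (Γ : Subgroup G) (x : G) :
    SubMulAction (Subgroup.zpowers (MulOpposite.op x)) (Set G) where
  carrier := rightCosets Γ
  smul_mem' := by
    rintro ⟨a, ha⟩ _ ⟨g, rfl⟩
    refine ⟨g * a.unop, ?_⟩
    simp only [Subgroup.mk_smul, smul_smul]
    simp

/-- Burnside's lemma needs an action on the set of cosets itself, whereas `cosetOrbits` takes orbits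
inside `Set G`; the two notions of orbit agree because the cosets form an invariant subset. -/
theorem card_orbitRel_rightCosetsAction (Γ : Subgroup G) (x : G) :
    Nat.card (MulAction.orbitRel.Quotient (Subgroup.zpowers (MulOpposite.op x))
      (rightCosetsAction Γ x)) = cosetOrbits Γ x := by
  rw [cosetOrbits, ← Nat.card_coe_set_eq]
  have key : ∀ C D : rightCosetsAction Γ x,
      MulAction.orbitRel (Subgroup.zpowers (MulOpposite.op x)) _ C D ↔
      MulAction.orbit (Subgroup.zpowers (MulOpposite.op x)) (C : Set G) =
        MulAction.orbit (Subgroup.zpowers (MulOpposite.op x)) (D : Set G) := by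
    intro C D
    rw [MulAction.orbitRel_apply, MulAction.orbit_eq_iff]
    constructor
    · rintro ⟨a, rfl⟩
      exact ⟨a, rfl⟩
    · rintro ⟨a, ha⟩
      exact ⟨a, Subtype.ext ha⟩
  refine Nat.card_eq_of_bijective
    (Quotient.lift (fun C => ⟨MulAction.orbit (Subgroup.zpowers (MulOpposite.op x)) (C : Set G),
      (C : Set G), C.2, rfl⟩) fun C D h => Subtype.ext ((key C D).1 h)) ⟨?_, ?_⟩
  · rintro ⟨C⟩ ⟨D⟩ h
    exact Quotient.sound ((key C D).2 (congrArg Subtype.val h))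
  · rintro ⟨_, C, hC, rfl⟩
    exact ⟨Quotient.mk _ ⟨C, hC⟩, rfl⟩

theorem card_fixedBy_rightCosetsAction (Γ : Subgroup G) (x : G)
    (a : Subgroup.zpowers (MulOpposite.op x)) :
    Nat.card (MulAction.fixedBy (rightCosetsAction Γ x) a) = fixedCosets Γ a.1.unop := by
  rw [fixedCosets, ← Nat.card_coe_set_eq]
  refine Nat.card_eq_of_bijective (fun C => ⟨C.1.1, C.1.2, congrArg Subtype.val C.2⟩) ⟨?_, ?_⟩
  · intro C D h
    have h' : (C.1.1 : Set G) = D.1.1 := congrArg (fun E => E.1) h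
    exact Subtype.ext (Subtype.ext h')
  · rintro ⟨C, hC, h⟩
    exact ⟨⟨⟨C, hC⟩, Subtype.ext h⟩, rfl⟩

/-- Burnside's formula for the orbits of `x` on the right cosets of `Γ`. -/
theorem cosetOrbits_mul [Finite G] (Γ : Subgroup G) (x : G) :
    cosetOrbits Γ x * orderOf x * Nat.card Γ =
      ∑ k ∈ Finset.range (orderOf x), Nat.card {g : G // g * x ^ k * g⁻¹ ∈ Γ} := by
  classical
  have := Fintype.ofFinite G
  have := Fintype.ofFinite (rightCosetsAction Γ x)
  have : Finite Gᵐᵒᵖ := Finite.of_equiv G MulOpposite.opEquiv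
  have := Fintype.ofFinite (Subgroup.zpowers (MulOpposite.op x))
  have hord : orderOf (MulOpposite.op x) = orderOf x := by
    simp [orderOf_eq_orderOf_iff, ← MulOpposite.op_pow]
  have burnside := MulAction.sum_card_fixedBy_eq_card_orbits_mul_card_group
    (Subgroup.zpowers (MulOpposite.op x)) (rightCosetsAction Γ x)
  simp only [← Nat.card_eq_fintype_card] at burnside
  rw [show Nat.card (Quotient (MulAction.orbitRel (Subgroup.zpowers (MulOpposite.op x))
    (rightCosetsAction Γ x))) = _ from card_orbitRel_rightCosetsAction Γ x,
    Nat.card_zpowers, hord] at burnside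
  rw [← burnside, Finset.sum_mul]
  simp only [card_fixedBy_rightCosetsAction, ← card_conj_mem]
  have hx : IsOfFinOrder (MulOpposite.op x) := isOfFinOrder_of_finite _
  rw [← Fin.sum_univ_eq_sum_range (fun k => Nat.card {g : G // g * x ^ k * g⁻¹ ∈ Γ}),
    ← hord]
  symm
  refine Fintype.sum_equiv (finEquivZPowers hx) _ _ fun k => ?_
  rw [show ((finEquivZPowers hx k).1).unop = x ^ (k : ℕ) by simp [finEquivZPowers_apply hx]]

end Cosets

/-! ### The group C_sp^* as a group of monomial matrices -/

/-- The invertible matrices `(a b; c d)` with `ab = 0` and `cd = 0`. Over a local ring, these are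
the invertible matrices that are diagonal or antidiagonal. -/
def monomial (R : Type*) [CommRing R] : Subgroup (GL (Fin 2) R) where
  carrier := {g | g.1 0 0 * g.1 0 1 = 0 ∧ g.1 1 0 * g.1 1 1 = 0}
  one_mem' := by simp
  mul_mem' := by
    rintro a b ⟨ha, ha'⟩ ⟨hb, hb'⟩
    simp only [Set.mem_ofPred_eq, Units.val_mul, Matrix.mul_apply, Fin.sum_univ_two]
    constructor
    · linear_combination (a.1 0 0) ^ 2 * hb + (a.1 0 1) ^ 2 * hb' +
        (b.1 0 0 * b.1 1 1 + b.1 1 0 * b.1 0 1) * ha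
    · linear_combination (a.1 1 0) ^ 2 * hb + (a.1 1 1) ^ 2 * hb' +
        (b.1 0 0 * b.1 1 1 + b.1 1 0 * b.1 0 1) * ha'
  inv_mem' := by
    rintro a ⟨ha, ha'⟩
    have hdet : IsUnit (a.1.det) := (Matrix.isUnit_iff_isUnit_det _).1 a.isUnit
    -- The row products of the adjugate are, up to sign, the column products of the matrix. These
    -- vanish because their product with the unit determinant is a combination of the row products.
    have h1 : a.1 0 1 * a.1 1 1 = 0 := by
      refine hdet.mul_left_cancel ?_
      rw [Matrix.det_fin_two]
      linear_combination (a.1 1 1) ^ 2 * ha - (a.1 0 1) ^ 2 * ha'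
    have h2 : a.1 0 0 * a.1 1 0 = 0 := by
      refine hdet.mul_left_cancel ?_
      rw [Matrix.det_fin_two]
      linear_combination (a.1 0 0) ^ 2 * ha' - (a.1 1 0) ^ 2 * ha
    simp only [Set.mem_ofPred_eq, Matrix.coe_units_inv, Matrix.inv_def, Matrix.adjugate_fin_two,
      Matrix.smul_apply, smul_eq_mul, Matrix.of_apply, Matrix.cons_val', Matrix.cons_val_zero,
      Matrix.cons_val_one, Matrix.cons_val_fin_one]
    constructor
    · linear_combination -(Ring.inverse a.1.det) ^ 2 * h1
    · linear_combination -(Ring.inverse a.1.det) ^ 2 * h2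

theorem mem_monomial {R : Type*} [CommRing R] {g : GL (Fin 2) R} :
    g ∈ monomial R ↔ g.1 0 0 * g.1 0 1 = 0 ∧ g.1 1 0 * g.1 1 1 = 0 := Iff.rfl

theorem map_mem_monomial {R S : Type*} [CommRing R] [CommRing S] (f : R →+* S) {g : GL (Fin 2) R}
    (hg : g ∈ monomial R) : Matrix.GeneralLinearGroup.map f g ∈ monomial S := by
  rw [mem_monomial] at hg ⊢
  simp [← map_mul, hg.1, hg.2]

theorem zmod_ext_of_coprime {N m n : ℕ} [NeZero N] (hm : m ∣ N) (hn : n ∣ N) (hmn : m.Coprime n)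
    (hN : N ∣ m * n) {x y : ZMod N}
    (h1 : ZMod.castHom hm (ZMod m) x = ZMod.castHom hm (ZMod m) y)
    (h2 : ZMod.castHom hn (ZMod n) x = ZMod.castHom hn (ZMod n) y) : x = y := by
  rw [← sub_eq_zero, ← map_sub] at h1 h2
  rw [← sub_eq_zero]
  generalize x - y = z at h1 h2
  rw [← ZMod.natCast_zmod_val z, map_natCast, ZMod.natCast_eq_zero_iff] at h1 h2
  rw [← ZMod.natCast_zmod_val z, ZMod.natCast_eq_zero_iff]
  exact hN.trans (hmn.mul_dvd_of_dvd_of_dvd h1 h2)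

theorem zmod_eq_zero_of_ordProj {N : ℕ} [NeZero N] {x : ZMod N}
    (h : ∀ p ∈ N.primeFactors, ZMod.castHom (Nat.ordProj_dvd N p) (ZMod (ordProj[p] N)) x = 0) :
    x = 0 := by
  have hN := NeZero.ne N
  rw [← ZMod.natCast_zmod_val x, ZMod.natCast_eq_zero_iff]
  by_cases hx : x.val = 0
  · simp [hx]
  rw [← Nat.factorization_prime_le_iff_dvd hN hx]
  intro p hp
  by_cases hpN : p ∣ N
  · have := h p (Nat.mem_primeFactors.2 ⟨hp, hpN, hN⟩)
    rw [← ZMod.natCast_zmod_val x, map_natCast, ZMod.natCast_eq_zero_iff] at this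
    exact (hp.pow_dvd_iff_le_factorization hx).1 this
  · simp [Nat.factorization_eq_zero_of_not_dvd hpN]

theorem coprime_ordProj_ordCompl {N p : ℕ} (hN : N ≠ 0) (hp : p.Prime) :
    (ordProj[p] N).Coprime (ordCompl[p] N) :=
  (Nat.coprime_ordCompl hp hN).pow_left _

theorem IsInvolutionAt.mem_monomial {N p : ℕ} [NeZero N] (hp : p.Prime) {w : GL (Fin 2) (ZMod N)}
    (hw : IsInvolutionAt N p w) : w ∈ monomial (ZMod N) := by
  have h1 : ∀ i j, ZMod.castHom (Nat.ordProj_dvd N p) (ZMod (ordProj[p] N)) (w.1 i j) =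
      (swap (ZMod (ordProj[p] N))).1 i j := fun i j => by
    rw [← hw.1]; simp
  have h2 : ∀ i j, ZMod.castHom (Nat.ordCompl_dvd N p) (ZMod (ordCompl[p] N)) (w.1 i j) =
      (1 : Matrix (Fin 2) (Fin 2) (ZMod (ordCompl[p] N))) i j := fun i j => by
    rw [← Units.val_one, ← hw.2]; simp
  constructor <;>
  · refine zmod_ext_of_coprime (Nat.ordProj_dvd N p) (Nat.ordCompl_dvd N p)
      (coprime_ordProj_ordCompl (NeZero.ne N) hp) (Nat.ordProj_mul_ordCompl_eq_self N p).symm.dvd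
      ?_ ?_
    · rw [map_mul, h1, h1]; simp [swap]
    · rw [map_mul, h2, h2]; simp

theorem exists_isInvolutionAt {N p : ℕ} [NeZero N] (hp : p.Prime) :
    ∃ w : GL (Fin 2) (ZMod N), IsInvolutionAt N p w := by
  have hN := NeZero.ne N
  obtain ⟨e, he1, he2⟩ := Nat.chineseRemainder (coprime_ordProj_ordCompl hN hp) 1 0
  have h1 : ZMod.castHom (Nat.ordProj_dvd N p) (ZMod (ordProj[p] N)) (e : ZMod N) = 1 := by
    rw [map_natCast]
    simpa using (ZMod.natCast_eq_natCast_iff _ _ _).2 he1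
  have h2 : ZMod.castHom (Nat.ordCompl_dvd N p) (ZMod (ordCompl[p] N)) (e : ZMod N) = 0 := by
    rw [map_natCast]
    simpa using (ZMod.natCast_eq_natCast_iff _ _ _).2 he2
  generalize (e : ZMod N) = e at h1 h2
  have hee : e * e = e := zmod_ext_of_coprime (Nat.ordProj_dvd N p) (Nat.ordCompl_dvd N p)
      (coprime_ordProj_ordCompl hN hp) (Nat.ordProj_mul_ordCompl_eq_self N p).symm.dvd
      (by rw [map_mul, h1, mul_one]) (by rw [map_mul, h2, mul_zero])
  -- The idempotent e is 1 at p and 0 away from p, so this matrix interpolates between the swap and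
  -- the identity.
  have hsq : (!![1 - e, e; e, 1 - e] : Matrix (Fin 2) (Fin 2) (ZMod N)) * !![1 - e, e; e, 1 - e] =
      1 := by
    ext i j
    fin_cases i <;> fin_cases j <;> simp [Matrix.mul_apply, Fin.sum_univ_two] <;>
      first
      | linear_combination (2 : ZMod N) * hee
      | linear_combination (-2 : ZMod N) * hee
  refine ⟨⟨_, _, hsq, hsq⟩, ?_, ?_⟩
  · ext i j
    fin_cases i <;> fin_cases j <;> simp [-ZMod.castHom_apply, h1, swap]
  · ext i j
    fin_cases i <;> fin_cases j <;> simp [-ZMod.castHom_apply, h2]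

theorem cartanStar_le_monomial (N : ℕ) [NeZero N] : cartanStar N ≤ monomial (ZMod N) := by
  rw [cartanStar, Subgroup.closure_le]
  rintro g (⟨h1, h2⟩ | ⟨p, hp, hw⟩)
  · exact ⟨by rw [h1, mul_zero], by rw [h2, zero_mul]⟩
  · exact hw.mem_monomial (Nat.prime_of_mem_primeFactors hp)

theorem isLocalRing_zmod_prime_pow {p k : ℕ} (hp : p.Prime) (hk : k ≠ 0) :
    IsLocalRing (ZMod (p ^ k)) := by
  have : Fact (1 < p ^ k) := ⟨Nat.one_lt_pow hk hp.one_lt⟩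
  have : NeZero (p ^ k) := ⟨(pow_pos hp.pos k).ne'⟩
  refine IsLocalRing.of_nonunits_add fun a b ha hb => ?_
  rw [mem_nonunits_iff] at *
  have key : ∀ x : ZMod (p ^ k), ¬ IsUnit x ↔ p ∣ x.val := fun x => by
    rw [← ZMod.natCast_zmod_val x, ZMod.isUnit_iff_coprime, Nat.coprime_pow_right_iff
      (Nat.pos_of_ne_zero hk), Nat.coprime_comm, hp.coprime_iff_not_dvd, not_not,
      ZMod.natCast_zmod_val]
  rw [key] at *
  rw [ZMod.val_add]
  exact (Nat.dvd_mod_iff (dvd_pow_self p hk)).2 (dvd_add ha hb)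

/-- Since ad − bc is a unit of a local ring, ad or bc is a unit; the two equations then kill the
other two entries. -/
theorem mem_monomial_iff {R : Type*} [CommRing R] [IsLocalRing R] {g : GL (Fin 2) R} :
    g ∈ monomial R ↔ (g.1 0 1 = 0 ∧ g.1 1 0 = 0) ∨ (g.1 0 0 = 0 ∧ g.1 1 1 = 0) := by
  rw [mem_monomial]
  constructor
  · rintro ⟨h1, h2⟩
    have hdet : IsUnit (a := g.1.det) := (Matrix.isUnit_iff_isUnit_det _).1 g.isUnit
    rw [Matrix.det_fin_two, sub_eq_add_neg] at hdet
    rcases IsLocalRing.isUnit_or_isUnit_of_isUnit_add hdet with h | h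
    · left
      exact ⟨(isUnit_of_mul_isUnit_left h).mul_right_eq_zero.1 h1,
        (isUnit_of_mul_isUnit_right h).mul_left_eq_zero.1 h2⟩
    · right
      rw [IsUnit.neg_iff] at h
      exact ⟨(isUnit_of_mul_isUnit_left h).mul_left_eq_zero.1 h1,
        (isUnit_of_mul_isUnit_right h).mul_right_eq_zero.1 h2⟩
  · rintro (⟨h1, h2⟩ | ⟨h1, h2⟩) <;> simp [h1, h2]

/-- Induction on a set S of primes containing all those where g fails to be diagonal. At such a
prime p the matrix is antidiagonal, and multiplying by w_p makes it diagonal there without changing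
it at the other primes. -/
theorem monomial_le_cartanStar (N : ℕ) [NeZero N] : monomial (ZMod N) ≤ cartanStar N := by
  have hN := NeZero.ne N
  set φ : ∀ p : ℕ, ZMod N →+* ZMod (ordProj[p] N) := fun p =>
    ZMod.castHom (Nat.ordProj_dvd N p) (ZMod (ordProj[p] N)) with hφ
  have main : ∀ S : Finset ℕ, ∀ g ∈ monomial (ZMod N),
      (∀ p ∈ N.primeFactors, p ∉ S → φ p (g.1 0 1) = 0 ∧ φ p (g.1 1 0) = 0) →
      g ∈ cartanStar N := by
    intro S
    induction S using Finset.induction_on with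
    | empty =>
      intro g _ h
      refine Subgroup.subset_closure (Or.inl ⟨?_, ?_⟩)
      · exact zmod_eq_zero_of_ordProj fun p hp => (h p hp (by simp)).1
      · exact zmod_eq_zero_of_ordProj fun p hp => (h p hp (by simp)).2
    | insert p S _ ih =>
      intro g hg h
      by_cases hp : p ∈ N.primeFactors ∧ ¬ (φ p (g.1 0 1) = 0 ∧ φ p (g.1 1 0) = 0)
      · obtain ⟨hpN, hnd⟩ := hp
        have hpp := Nat.prime_of_mem_primeFactors hpN
        obtain ⟨w, hw⟩ := exists_isInvolutionAt (N := N) hpp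
        have hwmem : w ∈ cartanStar N := Subgroup.subset_closure (Or.inr ⟨p, hpN, hw⟩)
        rw [← Subgroup.mul_mem_cancel_right _ hwmem]
        refine ih _ ((monomial _).mul_mem hg (hw.mem_monomial hpp)) fun q hq hqS => ?_
        by_cases hqp : q = p
        · subst hqp
          have hν : N.factorization q ≠ 0 :=
            (hpp.factorization_pos_of_dvd hN (Nat.dvd_of_mem_primeFactors hpN)).ne'
          have := isLocalRing_zmod_prime_pow hpp hν
          have hloc := mem_monomial_iff.1 (map_mem_monomial (φ q) hg)
          simp only [Matrix.GeneralLinearGroup.map_apply] at hloc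
          have h1 : ∀ i j, φ q (w.1 i j) = (swap (ZMod (ordProj[q] N))).1 i j := fun i j => by
            rw [← hw.1]; simp [hφ]
          obtain ⟨h00, h11⟩ := hloc.resolve_left hnd
          constructor
          · rw [Units.val_mul, Matrix.mul_apply, Fin.sum_univ_two, map_add, map_mul, map_mul,
              h1, h1, h00]
            simp [swap]
          · rw [Units.val_mul, Matrix.mul_apply, Fin.sum_univ_two, map_add, map_mul, map_mul,
              h1, h1, h11]
            simp [swap]
        · have hqq := Nat.prime_of_mem_primeFactors hq
          have hdvd : ordProj[q] N ∣ ordCompl[p] N := by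
            refine (Nat.Coprime.pow _ _ ((Nat.coprime_primes hqq hpp).2 hqp)).dvd_of_dvd_mul_left
              ((Nat.ordProj_dvd N q).trans (Nat.ordProj_mul_ordCompl_eq_self N p).symm.dvd)
          have h2 : ∀ i j, φ q (w.1 i j) =
              (1 : Matrix (Fin 2) (Fin 2) (ZMod (ordProj[q] N))) i j := fun i j => by
            have h3 : ZMod.castHom (Nat.ordCompl_dvd N p) (ZMod (ordCompl[p] N)) (w.1 i j) =
                (1 : Matrix (Fin 2) (Fin 2) (ZMod (ordCompl[p] N))) i j := by
              rw [← Units.val_one, ← hw.2]; simp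
            have h4 : φ q = (ZMod.castHom hdvd (ZMod (ordProj[q] N))).comp
                (ZMod.castHom (Nat.ordCompl_dvd N p) (ZMod (ordCompl[p] N))) :=
              Subsingleton.elim _ _
            rw [h4, RingHom.comp_apply, h3]
            simp only [Matrix.one_apply]
            split_ifs
            · exact map_one _
            · exact map_zero _
          obtain ⟨h01, h10⟩ := h q hq (by simp [hqp, hqS])
          constructor
          · rw [Units.val_mul, Matrix.mul_apply, Fin.sum_univ_two, map_add, map_mul, map_mul,
              h2, h2, h01]
            simp
          · rw [Units.val_mul, Matrix.mul_apply, Fin.sum_univ_two, map_add, map_mul, map_mul,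
              h2, h2, h10]
            simp
      · refine ih g hg fun q hq hqS => ?_
        by_cases hqp : q = p
        · subst hqp
          by_contra hc
          exact hp ⟨hq, hc⟩
        · exact h q hq (by simp [hqp, hqS])
  intro g hg
  exact main N.primeFactors g hg fun p hp hp' => absurd hp hp'

theorem cartanStar_eq_monomial (N : ℕ) [NeZero N] : cartanStar N = monomial (ZMod N) :=
  le_antisymm (cartanStar_le_monomial N) (monomial_le_cartanStar N)

/-! ### Multiplicativity of the counts in N -/

/-- The condition defining `monomial`, for matrices of determinant one. -/
def IsMono {R : Type*} [CommRing R] (g : SL(2, R)) : Prop :=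
  g.1 0 0 * g.1 0 1 = 0 ∧ g.1 1 0 * g.1 1 1 = 0

theorem mem_slPart_cartanStar {N : ℕ} [NeZero N] (g : SL(2, ZMod N)) :
    g ∈ slPart (cartanStar N) ↔ IsMono g := by
  rw [cartanStar_eq_monomial]
  rfl

/-- The number of `g` in `SL₂(R)` such that `g x g⁻¹` is monomial. -/
noncomputable def conjCount (R : Type*) [CommRing R] (x : SL(2, ℤ)) : ℕ :=
  Nat.card {g : SL(2, R) //
    IsMono (g * Matrix.SpecialLinearGroup.map (Int.castRingHom R) x * g⁻¹)}

/-- The number of monomial matrices in `SL₂(R)`. -/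
noncomputable def monoCount (R : Type*) [CommRing R] : ℕ :=
  Nat.card {g : SL(2, R) // IsMono g}

theorem card_slPart_cartanStar (N : ℕ) [NeZero N] :
    Nat.card (slPart (cartanStar N)) = monoCount (ZMod N) :=
  Nat.card_congr (Equiv.subtypeEquivRight mem_slPart_cartanStar)

theorem fixedCosets_mul_monoCount {N : ℕ} [NeZero N] (x : SL(2, ℤ)) :
    fixedCosets (slPart (cartanStar N)) (Matrix.SpecialLinearGroup.map (Int.castRingHom _) x) *
      monoCount (ZMod N) = conjCount (ZMod N) x := by
  rw [← card_slPart_cartanStar, ← card_conj_mem]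
  exact Nat.card_congr (Equiv.subtypeEquivRight fun g => mem_slPart_cartanStar _)

theorem monoCount_pos (R : Type*) [CommRing R] [Finite R] : 0 < monoCount R := by
  have : Nonempty {g : SL(2, R) // IsMono g} := ⟨1, by simp [IsMono]⟩
  exact Nat.card_pos

section Product

variable {R A B : Type*} [CommRing R] [CommRing A] [CommRing B]

theorem IsMono.map_iff (e : R ≃+* A × B) (g : SL(2, R)) :
    IsMono g ↔
      IsMono (Matrix.SpecialLinearGroup.map ((RingHom.fst A B).comp e.toRingHom) g) ∧
      IsMono (Matrix.SpecialLinearGroup.map ((RingHom.snd A B).comp e.toRingHom) g) := by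
  have key : ∀ x y : R, x * y = 0 ↔ (e x).1 * (e y).1 = 0 ∧ (e x).2 * (e y).2 = 0 := fun x y => by
    rw [← map_eq_zero_iff e e.injective, map_mul, Prod.ext_iff]
    rfl
  simp only [IsMono, key]
  simp only [Matrix.SpecialLinearGroup.map_apply_coe, RingHom.mapMatrix_apply, Matrix.map_apply,
    RingHom.comp_apply, RingHom.coe_fst, RingHom.coe_snd, RingEquiv.toRingHom_eq_coe,
    RingHom.coe_coe]
  tauto

theorem card_specialLinear_prod (e : R ≃+* A × B) (P : SL(2, R) → Prop) (Q : SL(2, A) → Prop)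
    (T : SL(2, B) → Prop)
    (h : ∀ g, P g ↔ Q (Matrix.SpecialLinearGroup.map ((RingHom.fst A B).comp e.toRingHom) g) ∧
      T (Matrix.SpecialLinearGroup.map ((RingHom.snd A B).comp e.toRingHom) g)) :
    Nat.card {g // P g} = Nat.card {g // Q g} * Nat.card {g // T g} := by
  rw [← Nat.card_prod]
  refine Nat.card_eq_of_bijective
    (fun g => (⟨_, ((h g.1).1 g.2).1⟩, ⟨_, ((h g.1).1 g.2).2⟩)) ⟨?_, ?_⟩
  · intro g g' hgg
    rw [Prod.ext_iff, Subtype.ext_iff, Subtype.ext_iff] at hgg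
    obtain ⟨h1, h2⟩ := hgg
    refine Subtype.ext (Matrix.SpecialLinearGroup.ext _ _ fun i j => e.injective (Prod.ext ?_ ?_))
    · simpa using congrArg (fun m : SL(2, A) => m.1 i j) h1
    · simpa using congrArg (fun m : SL(2, B) => m.1 i j) h2
  · rintro ⟨⟨a, ha⟩, ⟨b, hb⟩⟩
    have hdet : (Matrix.of fun i j => e.symm (a.1 i j, b.1 i j)).det = 1 := by
      apply e.injective
      have h1 := a.2
      have h2 := b.2
      rw [Matrix.det_fin_two] at h1 h2 ⊢
      simp [h1, h2, Prod.ext_iff]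
    have h1 : Matrix.SpecialLinearGroup.map ((RingHom.fst A B).comp e.toRingHom) ⟨_, hdet⟩ = a := by
      ext i j
      exact congrArg Prod.fst (e.apply_symm_apply (a.1 i j, b.1 i j))
    have h2 : Matrix.SpecialLinearGroup.map ((RingHom.snd A B).comp e.toRingHom) ⟨_, hdet⟩ = b := by
      ext i j
      exact congrArg Prod.snd (e.apply_symm_apply (a.1 i j, b.1 i j))
    refine ⟨⟨⟨_, hdet⟩, (h _).2 ⟨?_, ?_⟩⟩, ?_⟩
    · rwa [h1]
    · rwa [h2]
    · exact Prod.ext (Subtype.ext h1) (Subtype.ext h2)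

theorem monoCount_prod (e : R ≃+* A × B) : monoCount R = monoCount A * monoCount B :=
  card_specialLinear_prod e _ _ _ (IsMono.map_iff e)

theorem map_map_intCast (f : R →+* A) (x : SL(2, ℤ)) :
    Matrix.SpecialLinearGroup.map f (Matrix.SpecialLinearGroup.map (Int.castRingHom R) x) =
      Matrix.SpecialLinearGroup.map (Int.castRingHom A) x := by
  ext i j
  simp

theorem conjCount_prod (e : R ≃+* A × B) (x : SL(2, ℤ)) :
    conjCount R x = conjCount A x * conjCount B x := by
  refine card_specialLinear_prod e _ _ _ fun g => ?_
  rw [IsMono.map_iff e]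
  simp only [map_mul, map_inv, map_map_intCast]

theorem conjCount_one : conjCount R 1 = Nat.card SL(2, R) := by
  refine Nat.card_congr (Equiv.subtypeUnivEquiv fun g => ?_)
  simp [IsMono]

end Product

/-- A function of `N` that is multiplicative is the product of its values at the prime powers
exactly dividing `N`. -/
theorem eq_prod_primeFactors {f : ℕ → ℚ} (h1 : f 1 = 1)
    (hmul : ∀ m n : ℕ, m ≠ 0 → n ≠ 0 → m.Coprime n → f (m * n) = f m * f n) {N : ℕ} (hN : N ≠ 0) :
    f N = ∏ p ∈ N.primeFactors, f (p ^ N.factorization p) := by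
  refine Nat.multiplicative_factorization f (fun m n hmn => ?_) h1 hN
  rcases eq_or_ne m 0 with rfl | hm
  · obtain rfl : n = 1 := by simpa using hmn
    simp [h1]
  rcases eq_or_ne n 0 with rfl | hn
  · obtain rfl : m = 1 := by simpa using hmn
    simp [h1]
  exact hmul m n hm hn hmn

theorem conjCount_div_monoCount (x : SL(2, ℤ)) {N : ℕ} (hN : N ≠ 0) :
    (conjCount (ZMod N) x : ℚ) / monoCount (ZMod N) =
      ∏ p ∈ N.primeFactors, (conjCount (ZMod (p ^ N.factorization p)) x : ℚ) /
        monoCount (ZMod (p ^ N.factorization p)) := by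
  refine eq_prod_primeFactors (f := fun n => (conjCount (ZMod n) x : ℚ) / monoCount (ZMod n))
    ?_ ?_ hN
  · have : Subsingleton (ZMod 1) := inferInstanceAs (Subsingleton (Fin 1))
    have hs : Subsingleton SL(2, ZMod 1) :=
      ⟨fun a b => Matrix.SpecialLinearGroup.ext _ _ fun i j => Subsingleton.elim _ _⟩
    have h1 : conjCount (ZMod 1) x = 1 := by
      rw [conjCount, Nat.card_eq_one_iff_unique]
      exact ⟨inferInstance, ⟨1, Subsingleton.elim _ _, Subsingleton.elim _ _⟩⟩
    have h2 : monoCount (ZMod 1) = 1 := by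
      rw [monoCount, Nat.card_eq_one_iff_unique]
      exact ⟨inferInstance, ⟨1, Subsingleton.elim _ _, Subsingleton.elim _ _⟩⟩
    simp [h1, h2]
  · intro m n _ _ hmn
    rw [conjCount_prod (ZMod.chineseRemainder hmn), monoCount_prod (ZMod.chineseRemainder hmn)]
    push_cast
    rw [mul_div_mul_comm]

theorem fixedCosets_eq_prod (x : SL(2, ℤ)) {N : ℕ} [NeZero N] :
    (fixedCosets (slPart (cartanStar N))
      (Matrix.SpecialLinearGroup.map (Int.castRingHom _) x) : ℚ) =
      ∏ p ∈ N.primeFactors, (conjCount (ZMod (p ^ N.factorization p)) x : ℚ) /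
        monoCount (ZMod (p ^ N.factorization p)) := by
  have h0 : (monoCount (ZMod N) : ℚ) ≠ 0 := by exact_mod_cast (monoCount_pos _).ne'
  rw [← conjCount_div_monoCount x (NeZero.ne N), eq_div_iff h0]
  exact_mod_cast fixedCosets_mul_monoCount x

/-! ### Counting over a local ring -/

section Local

variable {R : Type*} [CommRing R]

theorem sl_two_ext {g h : SL(2, R)} (h00 : g.1 0 0 = h.1 0 0) (h01 : g.1 0 1 = h.1 0 1)
    (h10 : g.1 1 0 = h.1 1 0) (h11 : g.1 1 1 = h.1 1 1) : g = h := by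
  ext i j
  fin_cases i <;> fin_cases j <;> assumption

theorem sl_two_det (g : SL(2, R)) : g.1 0 0 * g.1 1 1 - g.1 0 1 * g.1 1 0 = 1 := by
  rw [← Matrix.det_fin_two, g.2]

/-- The matrix `(a b; c d)` of determinant one. -/
def slMk (a b c d : R) (h : a * d - b * c = 1) : SL(2, R) :=
  ⟨!![a, b; c, d], by rw [Matrix.det_fin_two_of, h]⟩

theorem coe_slMk {a b c d : R} (h : a * d - b * c = 1) : (slMk a b c d h).1 = !![a, b; c, d] := rfl

theorem exists_slMk (g : SL(2, R)) : ∃ a b c d h, g = slMk a b c d h :=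
  ⟨_, _, _, _, sl_two_det g, sl_two_ext rfl rfl rfl rfl⟩

theorem slMk_inj {a b c d a' b' c' d' : R} {h h'} :
    slMk a b c d h = slMk a' b' c' d' h' ↔ a = a' ∧ b = b' ∧ c = c' ∧ d = d' := by
  constructor
  · intro H
    have key : ∀ i j, (slMk a b c d h).1 i j = (slMk a' b' c' d' h').1 i j := by simp [H]
    exact ⟨key 0 0, key 0 1, key 1 0, key 1 1⟩
  · rintro ⟨rfl, rfl, rfl, rfl⟩
    rfl

theorem isMono_iff [IsLocalRing R] (g : SL(2, R)) :
    IsMono g ↔ (g.1 0 1 = 0 ∧ g.1 1 0 = 0) ∨ (g.1 0 0 = 0 ∧ g.1 1 1 = 0) :=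
  mem_monomial_iff (g := Matrix.SpecialLinearGroup.toGL g)

theorem monoCount_eq [IsLocalRing R] [Finite R] : monoCount R = 2 * Nat.card Rˣ := by
  rw [two_mul, ← Nat.card_sum]
  symm
  have hl : ∀ u : Rˣ, IsMono (slMk (u : R) 0 0 ((u⁻¹ : Rˣ) : R) (by simp)) := fun u =>
    (isMono_iff _).2 (Or.inl ⟨rfl, rfl⟩)
  have hr : ∀ u : Rˣ, IsMono (slMk 0 (u : R) (-((u⁻¹ : Rˣ) : R)) 0 (by simp)) := fun u =>
    (isMono_iff _).2 (Or.inr ⟨rfl, rfl⟩)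
  refine Nat.card_eq_of_bijective (Sum.elim (fun u => (⟨_, hl u⟩ : {g : SL(2, R) // IsMono g}))
    (fun u => ⟨_, hr u⟩)) ⟨?_, ?_⟩
  · rintro (u | u) (v | v) h <;>
      simp only [Sum.elim_inl, Sum.elim_inr, Subtype.mk.injEq, slMk_inj] at h
    · rw [Units.ext h.1]
    · exact absurd h.1 u.ne_zero
    · exact absurd h.2.1 u.ne_zero
    · rw [Units.ext h.2.1]
  · rintro ⟨g, hg⟩
    obtain ⟨a, b, c, d, h, rfl⟩ := exists_slMk g
    rcases (isMono_iff _).1 hg with ⟨h1, h2⟩ | ⟨h1, h2⟩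
    · change b = 0 at h1
      change c = 0 at h2
      subst h1 h2
      have h' : a * d = 1 := by linear_combination h
      refine ⟨Sum.inl (Units.mkOfMulEqOne a d h'), Subtype.ext (sl_two_ext rfl rfl rfl rfl)⟩
    · change a = 0 at h1
      change d = 0 at h2
      subst h1 h2
      have h' : b * (-c) = 1 := by linear_combination h
      refine ⟨Sum.inr (Units.mkOfMulEqOne b (-c) h'), Subtype.ext (sl_two_ext rfl rfl ?_ rfl)⟩
      change -(-c) = c
      rw [neg_neg]

theorem isUnit_of_not_isUnit [IsLocalRing R] {a b c d : R} (h : a * d - b * c = 1)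
    (ha : ¬ IsUnit a) : IsUnit b := by
  have h1 : IsUnit (a * d + -(b * c)) := by rw [← sub_eq_add_neg, h]; exact isUnit_one
  rcases IsLocalRing.isUnit_or_isUnit_of_isUnit_add h1 with h2 | h2
  · exact absurd (isUnit_of_mul_isUnit_left h2) ha
  · rw [IsUnit.neg_iff] at h2
    exact isUnit_of_mul_isUnit_left h2

theorem card_not_isUnit [Finite R] : Nat.card {a : R // ¬ IsUnit a} = Nat.card R - Nat.card Rˣ := by
  classical
  have := Fintype.ofFinite R
  have h : Nat.card Rˣ = Nat.card {a : R // IsUnit a} := by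
    refine Nat.card_eq_of_bijective (fun u => ⟨u, u.isUnit⟩) ⟨fun u v h => ?_, ?_⟩
    · exact Units.ext (Subtype.ext_iff.1 h)
    · rintro ⟨_, u, rfl⟩
      exact ⟨u, rfl⟩
  rw [h]
  simp only [Nat.card_eq_fintype_card]
  exact Fintype.card_subtype_compl _

/-- If a is a unit, then b and c are free and d is determined; if not, b is a unit, d is free and c
is determined. -/
theorem card_specialLinear_two [IsLocalRing R] [Finite R] :
    Nat.card SL(2, R) = Nat.card Rˣ * Nat.card R * Nat.card R +
      (Nat.card R - Nat.card Rˣ) * Nat.card Rˣ * Nat.card R := by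
  rw [← card_not_isUnit]
  simp only [← Nat.card_prod]
  rw [← Nat.card_sum]
  symm
  refine Nat.card_eq_of_bijective (Sum.elim
    (fun x : (Rˣ × R) × R => slMk (x.1.1 : R) x.1.2 x.2 ((x.1.1⁻¹ : Rˣ) * (1 + x.1.2 * x.2))
      (by rw [← mul_assoc, Units.mul_inv]; ring))
    (fun x : ({a : R // ¬ IsUnit a} × Rˣ) × R =>
      slMk (x.1.1 : R) x.1.2 ((x.1.2⁻¹ : Rˣ) * (x.1.1 * x.2 - 1)) x.2
        (by rw [← mul_assoc, Units.mul_inv]; ring))) ⟨?_, ?_⟩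
  · rintro (⟨⟨u, b⟩, c⟩ | ⟨⟨⟨a, ha⟩, u⟩, d⟩) (⟨⟨u', b'⟩, c'⟩ | ⟨⟨⟨a', ha'⟩, u'⟩, d'⟩) h <;>
      simp only [Sum.elim_inl, Sum.elim_inr, slMk_inj] at h
    · obtain ⟨h1, rfl, rfl, -⟩ := h
      rw [Units.ext h1]
    · exact absurd (h.1 ▸ u.isUnit) ha'
    · exact absurd (h.1 ▸ u'.isUnit) ha
    · obtain ⟨rfl, h1, -, rfl⟩ := h
      rw [Units.ext h1]
  · intro g
    obtain ⟨a, b, c, d, h, rfl⟩ := exists_slMk g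
    by_cases ha : IsUnit a
    · obtain ⟨u, rfl⟩ := ha
      refine ⟨Sum.inl ((u, b), c), sl_two_ext rfl rfl rfl ?_⟩
      change ((u⁻¹ : Rˣ) : R) * (1 + b * c) = d
      rw [Units.inv_mul_eq_iff_eq_mul]
      linear_combination -h
    · obtain ⟨u, rfl⟩ := isUnit_of_not_isUnit h ha
      refine ⟨Sum.inr ((⟨a, ha⟩, u), d), sl_two_ext rfl rfl ?_ rfl⟩
      change ((u⁻¹ : Rˣ) : R) * (a * d - 1) = c
      rw [Units.inv_mul_eq_iff_eq_mul]
      linear_combination h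

/-- The matrix `(0 -1; 1 -t)`. -/
def ellipticMatrix (t : ℤ) : SL(2, ℤ) :=
  ⟨!![0, -1; 1, -t], by simp [Matrix.det_fin_two]⟩

theorem coe_ellipticMatrix (t : ℤ) : (ellipticMatrix t).1 = !![0, -1; 1, -t] := rfl

/-- The alternatives express that the conjugate is diagonal, respectively antidiagonal. The last two
equations differ by t(ad − bc) = t, reflecting the trace −t. -/
theorem isMono_conj_iff [IsLocalRing R] (t : ℤ) {a b c d : R} {h} :
    IsMono (slMk a b c d h * Matrix.SpecialLinearGroup.map (Int.castRingHom R) (ellipticMatrix t) *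
      (slMk a b c d h)⁻¹) ↔
      (a ^ 2 + t * a * b + b ^ 2 = 0 ∧ c ^ 2 + t * c * d + d ^ 2 = 0) ∨
      (a * c + b * d + t * b * c = 0 ∧ a * c + b * d + t * a * d = 0) := by
  rw [isMono_iff]
  have hx : (Matrix.SpecialLinearGroup.map (Int.castRingHom R) (ellipticMatrix t)).1 =
      !![0, -1; 1, -(t : R)] := by
    rw [Matrix.SpecialLinearGroup.map_apply_coe, coe_ellipticMatrix]
    ext i j
    fin_cases i <;> fin_cases j <;> simp
  rw [Matrix.SpecialLinearGroup.coe_mul, Matrix.SpecialLinearGroup.coe_mul,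
    Matrix.SpecialLinearGroup.coe_inv, hx, coe_slMk, Matrix.adjugate_fin_two_of,
    Matrix.mul_fin_two, Matrix.mul_fin_two]
  simp only [Matrix.of_apply, Matrix.cons_val', Matrix.cons_val_zero,
    Matrix.cons_val_one, Matrix.cons_val_fin_one]
  refine or_congr (and_congr ?_ ?_) (and_congr ?_ ?_)
  · rw [← neg_eq_zero]
    refine Eq.congr ?_ rfl
    ring
  · refine Eq.congr ?_ rfl
    ring
  · refine Eq.congr ?_ rfl
    ring
  · rw [← neg_eq_zero]
    refine Eq.congr ?_ rfl
    ring

/-- The number of simple roots of `r² + tr + 1` in `R`. -/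
noncomputable def rootCount (R : Type*) [CommRing R] (t : ℤ) : ℕ :=
  Nat.card {r : R // r ^ 2 + t * r + 1 = 0 ∧ IsUnit (2 * r + t)}

/-- The first row is u(1, r) with r a root, and the second is a multiple of (1, −t − r), given by
the conjugate root. The determinant condition makes the difference 2r + t of the roots a unit and
fixes the multiple. -/
theorem card_isotropic_rows [Nontrivial R] (t : ℤ) :
    Nat.card {g : SL(2, R) // g.1 0 0 ^ 2 + t * g.1 0 0 * g.1 0 1 + g.1 0 1 ^ 2 = 0 ∧
      g.1 1 0 ^ 2 + t * g.1 1 0 * g.1 1 1 + g.1 1 1 ^ 2 = 0} = Nat.card Rˣ * rootCount R t := by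
  rw [rootCount, ← Nat.card_prod]
  symm
  have hdet : ∀ x : Rˣ × {r : R // r ^ 2 + t * r + 1 = 0 ∧ IsUnit (2 * r + t)},
      (x.1 : R) * (((x.1⁻¹ * x.2.2.2.unit⁻¹ : Rˣ) : R) * (t + x.2.1)) -
        x.1 * x.2.1 * (-((x.1⁻¹ * x.2.2.2.unit⁻¹ : Rˣ) : R)) = 1 := by
    rintro ⟨u, r, h1, h2⟩
    have h3 := h2.unit.mul_inv
    rw [IsUnit.unit_spec] at h3
    have h4 := u.mul_inv
    simp only [Units.val_mul]
    linear_combination h3 * (u : R) * (u⁻¹ : Rˣ) + h4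
  refine Nat.card_eq_of_bijective (fun x => ⟨slMk _ _ _ _ (hdet x), ?_, ?_⟩) ⟨?_, ?_⟩
  · obtain ⟨u, r, h1, h2⟩ := x
    change (u : R) ^ 2 + t * u * (u * r) + (u * r) ^ 2 = 0
    linear_combination (u : R) ^ 2 * h1
  · obtain ⟨u, r, h1, h2⟩ := x
    change (-((u⁻¹ * h2.unit⁻¹ : Rˣ) : R)) ^ 2 + t * (-((u⁻¹ * h2.unit⁻¹ : Rˣ) : R)) *
      (((u⁻¹ * h2.unit⁻¹ : Rˣ) : R) * (t + r)) + (((u⁻¹ * h2.unit⁻¹ : Rˣ) : R) * (t + r)) ^ 2 = 0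
    generalize ((u⁻¹ * h2.unit⁻¹ : Rˣ) : R) = w
    linear_combination w ^ 2 * h1
  · rintro ⟨u, r, h1, h2⟩ ⟨u', r', h1', h2'⟩ h
    simp only [Subtype.mk.injEq, slMk_inj] at h
    obtain rfl : u = u' := Units.ext h.1
    obtain rfl : r = r' := u.isUnit.mul_left_cancel h.2.1
    rfl
  · rintro ⟨g, hg⟩
    obtain ⟨a, b, c, d, h, rfl⟩ := exists_slMk g
    obtain ⟨h1, h2⟩ := hg
    change a ^ 2 + t * a * b + b ^ 2 = 0 at h1
    change c ^ 2 + t * c * d + d ^ 2 = 0 at h2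
    -- Substituting b² = −a(a + tb) in (ad − bc)² = 1 exhibits a as a unit.
    have ha : a * (a * d ^ 2 - 2 * b * c * d - (a + t * b) * c ^ 2) = 1 := by
      linear_combination (a * d - b * c + 1) * h - c ^ 2 * h1
    obtain ⟨u, rfl⟩ : IsUnit a := IsUnit.of_mul_eq_one _ ha
    obtain ⟨r, rfl⟩ : ∃ r, b = u * r := ⟨(u⁻¹ : Rˣ) * b, by simp⟩
    have hr : r ^ 2 + t * r + 1 = 0 := by
      refine (u ^ 2).isUnit.mul_left_cancel ?_
      push_cast
      linear_combination h1
    -- The form at (c, d) factors as (d − rc)(d + (t + r)c), and u(d − rc) = 1 is the determinant.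
    have hd : d = -c * (t + r) := by
      linear_combination u * h2 - u * c ^ 2 * hr - (d + c * (t + r)) * h
    have hv : (2 * r + t) * (-(u * c)) = 1 := by
      linear_combination h - u * hd
    have hunit : IsUnit (2 * r + t) := IsUnit.of_mul_eq_one _ hv
    have hc : ((u⁻¹ * hunit.unit⁻¹ : Rˣ) : R) = -c := by
      rw [← mul_inv, Units.inv_eq_of_mul_eq_one_right]
      rw [Units.val_mul, IsUnit.unit_spec]
      linear_combination hv
    refine ⟨(u, ⟨r, hr, hunit⟩), Subtype.ext (sl_two_ext rfl rfl ?_ ?_)⟩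
    · change -((u⁻¹ * hunit.unit⁻¹ : Rˣ) : R) = c
      rw [hc, neg_neg]
    · change ((u⁻¹ * hunit.unit⁻¹ : Rˣ) : R) * (t + r) = d
      rw [hc, hd]

/-- An antidiagonal conjugate would have trace 0, but the trace is −1; only the diagonal case
remains. -/
theorem conjCount_ellipticMatrix_one [IsLocalRing R] :
    conjCount R (ellipticMatrix 1) = Nat.card Rˣ * rootCount R 1 := by
  rw [← card_isotropic_rows]
  refine Nat.card_congr (Equiv.subtypeEquivRight fun g => ?_)
  obtain ⟨a, b, c, d, h, rfl⟩ := exists_slMk g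
  rw [isMono_conj_iff]
  refine or_iff_left ?_
  rintro ⟨h1, h2⟩
  refine one_ne_zero (α := R) ?_
  push_cast at h1 h2
  linear_combination h2 - h1 - h

/-- By (a² + b²)(c² + d²) = (ad − bc)² + (ac + bd)², the norm of the first row is a unit, and the
second row must be (−b, a)/(a² + b²). -/
theorem card_orthogonal_rows :
    Nat.card {g : SL(2, R) // g.1 0 0 * g.1 1 0 + g.1 0 1 * g.1 1 1 = 0} =
      Nat.card {x : R × R // IsUnit (x.1 ^ 2 + x.2 ^ 2)} := by
  have hunit : ∀ {a b c d : R}, a * d - b * c = 1 → a * c + b * d = 0 →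
      (a ^ 2 + b ^ 2) * (d ^ 2 + c ^ 2) = 1 := fun {a b c d} h1 h2 => by
    linear_combination (a * d - b * c + 1) * h1 + (a * c + b * d) * h2
  refine Nat.card_eq_of_bijective (fun g => ⟨(g.1.1 0 0, g.1.1 0 1),
    IsUnit.of_mul_eq_one _ (hunit (sl_two_det g.1) g.2)⟩) ⟨?_, ?_⟩
  · rintro ⟨g, hg⟩ ⟨g', hg'⟩ hgg
    obtain ⟨a, b, c, d, h, rfl⟩ := exists_slMk g
    obtain ⟨a', b', c', d', h', rfl⟩ := exists_slMk g'
    have h0 := Subtype.ext_iff.1 hgg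
    obtain rfl : a = a' := congrArg Prod.fst h0
    obtain rfl : b = b' := congrArg Prod.snd h0
    change a * c + b * d = 0 at hg
    change a * c' + b * d' = 0 at hg'
    have hu : IsUnit (a ^ 2 + b ^ 2) := IsUnit.of_mul_eq_one _ (hunit h hg)
    refine Subtype.ext (sl_two_ext rfl rfl (hu.mul_left_cancel ?_) (hu.mul_left_cancel ?_))
    · change (a ^ 2 + b ^ 2) * c = (a ^ 2 + b ^ 2) * c'
      linear_combination a * hg - b * h - a * hg' + b * h'
    · change (a ^ 2 + b ^ 2) * d = (a ^ 2 + b ^ 2) * d'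
      linear_combination a * h + b * hg - a * h' - b * hg'
  · rintro ⟨⟨a, b⟩, u, hu⟩
    change (u : R) = a ^ 2 + b ^ 2 at hu
    have hinv := u.mul_inv
    rw [hu] at hinv
    refine ⟨⟨slMk a b (-b * (u⁻¹ : Rˣ)) (a * (u⁻¹ : Rˣ)) ?_, ?_⟩, rfl⟩
    · linear_combination hinv
    · change a * (-b * (u⁻¹ : Rˣ)) + b * (a * (u⁻¹ : Rˣ)) = 0
      ring

/-- If the second coordinate is a nonunit, the first can be any unit; if it is a unit u, the first
is su with s² + 1 a unit. -/
theorem card_isUnit_sq_add_sq [IsLocalRing R] [Finite R] :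
    Nat.card {x : R × R // IsUnit (x.1 ^ 2 + x.2 ^ 2)} =
      (Nat.card R - Nat.card Rˣ) * Nat.card Rˣ +
        Nat.card Rˣ * Nat.card {s : R // IsUnit (s ^ 2 + 1)} := by
  rw [← card_not_isUnit]
  simp only [← Nat.card_prod]
  rw [← Nat.card_sum]
  symm
  have hl : ∀ x : {a : R // ¬ IsUnit a} × Rˣ, IsUnit ((x.2 : R) ^ 2 + x.1.1 ^ 2) := by
    rintro ⟨⟨a, ha⟩, u⟩
    have h1 : IsUnit (((u : R) ^ 2 + a ^ 2) + -(a ^ 2)) := by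
      rw [add_neg_cancel_right]
      exact u.isUnit.pow 2
    refine (IsLocalRing.isUnit_or_isUnit_of_isUnit_add h1).resolve_right fun h2 => ha ?_
    rw [IsUnit.neg_iff] at h2
    exact (isUnit_pow_iff two_ne_zero).1 h2
  have hr : ∀ x : Rˣ × {s : R // IsUnit (s ^ 2 + 1)},
      IsUnit ((x.2.1 * x.1 : R) ^ 2 + (x.1 : R) ^ 2) := by
    rintro ⟨u, s, hs⟩
    have := (u.isUnit.pow 2).mul hs
    convert this using 1
    ring
  refine Nat.card_eq_of_bijective (Sum.elim
    (fun x => (⟨(_, _), hl x⟩ : {x : R × R // IsUnit (x.1 ^ 2 + x.2 ^ 2)}))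
    (fun x => ⟨(_, _), hr x⟩)) ⟨?_, ?_⟩
  · rintro (⟨⟨a, ha⟩, u⟩ | ⟨u, s, hs⟩) (⟨⟨a', ha'⟩, u'⟩ | ⟨u', s', hs'⟩) h <;>
      simp only [Sum.elim_inl, Sum.elim_inr, Subtype.mk.injEq, Prod.mk.injEq] at h
    · obtain ⟨h1, rfl⟩ := h
      rw [Units.ext h1]
    · exact absurd (h.2 ▸ u'.isUnit) ha
    · exact absurd (h.2 ▸ u.isUnit) ha'
    · obtain rfl : u = u' := Units.ext h.2
      obtain rfl : s = s' := u.isUnit.mul_right_cancel h.1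
      rfl
  · rintro ⟨⟨a, b⟩, h⟩
    change IsUnit (a ^ 2 + b ^ 2) at h
    by_cases hb : IsUnit b
    · obtain ⟨u, rfl⟩ := hb
      have hs : IsUnit ((a * (u⁻¹ : Rˣ)) ^ 2 + 1) := by
        have := ((u⁻¹).isUnit.pow 2).mul h
        convert this using 1
        have h1 := u.mul_inv
        linear_combination -(u * (u⁻¹ : Rˣ) + 1) * h1
      refine ⟨Sum.inr (u, ⟨_, hs⟩), Subtype.ext (Prod.ext ?_ rfl)⟩
      change a * (u⁻¹ : Rˣ) * u = a
      rw [mul_assoc, Units.inv_mul, mul_one]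
    · rcases IsLocalRing.isUnit_or_isUnit_of_isUnit_add h with h1 | h1
      · obtain ⟨u, rfl⟩ := (isUnit_pow_iff two_ne_zero).1 h1
        exact ⟨Sum.inl (⟨b, hb⟩, u), rfl⟩
      · exact absurd ((isUnit_pow_iff two_ne_zero).1 h1) hb

/-- For t = 0 the two antidiagonal equations coincide. The diagonal and antidiagonal cases exclude
each other by the same sum-of-squares identity. -/
theorem conjCount_ellipticMatrix_zero [IsLocalRing R] [Finite R] :
    conjCount R (ellipticMatrix 0) = Nat.card Rˣ * rootCount R 0 +
      ((Nat.card R - Nat.card Rˣ) * Nat.card Rˣ +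
        Nat.card Rˣ * Nat.card {s : R // IsUnit (s ^ 2 + 1)}) := by
  classical
  have := Fintype.ofFinite SL(2, R)
  rw [← card_isotropic_rows, ← card_isUnit_sq_add_sq, ← card_orthogonal_rows]
  simp only [conjCount, Nat.card_eq_fintype_card]
  rw [← Fintype.card_subtype_or_disjoint]
  · refine Fintype.card_congr (Equiv.subtypeEquivRight fun g => ?_)
    obtain ⟨a, b, c, d, h, rfl⟩ := exists_slMk g
    rw [isMono_conj_iff]
    refine or_congr Iff.rfl ?_
    simp [slMk]
  · rw [Pi.disjoint_iff]
    intro g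
    rw [Prop.disjoint_iff]
    obtain ⟨a, b, c, d, h, rfl⟩ := exists_slMk g
    rintro ⟨⟨h1, h2⟩, h3⟩
    change a ^ 2 + ((0 : ℤ) : R) * a * b + b ^ 2 = 0 at h1
    change c ^ 2 + ((0 : ℤ) : R) * c * d + d ^ 2 = 0 at h2
    change a * c + b * d = 0 at h3
    push_cast at h1 h2
    refine one_ne_zero (α := R) ?_
    linear_combination (c ^ 2 + d ^ 2) * h1 - (a * c + b * d) * h3 - (a * d - b * c + 1) * h

/-- For another root s, (s − r)(s + r + t) = 0, and the two factors differ by the unit 2r + t, so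
one of them is a unit and the other vanishes. -/
theorem rootCount_eq_two [IsLocalRing R] {t : ℤ} {r : R} (h : r ^ 2 + t * r + 1 = 0)
    (hu : IsUnit (2 * r + t)) : rootCount R t = 2 := by
  have hset : {s : R | s ^ 2 + t * s + 1 = 0 ∧ IsUnit (2 * s + t)} = {r, -t - r} := by
    ext s
    simp only [Set.mem_ofPred_eq, Set.mem_insert_iff, Set.mem_singleton_iff]
    constructor
    · rintro ⟨hs, -⟩
      have h0 : (s - r) * (r + s + t) = 0 := by linear_combination hs - h
      have h1 : IsUnit ((r + s + t) + -(s - r)) := by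
        convert hu using 1
        ring
      rcases IsLocalRing.isUnit_or_isUnit_of_isUnit_add h1 with h2 | h2
      · left
        exact sub_eq_zero.1 (h2.mul_left_eq_zero.1 h0)
      · right
        rw [IsUnit.neg_iff] at h2
        linear_combination h2.mul_right_eq_zero.1 h0
    · rintro (rfl | rfl)
      · exact ⟨h, hu⟩
      · refine ⟨by linear_combination h, ?_⟩
        rw [← IsUnit.neg_iff]
        convert hu using 1
        ring
  have hne : r ≠ -t - r := fun hr => by
    refine hu.ne_zero ?_
    linear_combination hr
  have := Set.ncard_pair hne
  rw [← hset] at this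
  exact this

end Local

/-! ### Roots and local factors at prime powers -/

section PrimePower

theorem isUnit_intCast_prime_pow {p k : ℕ} [hp : Fact p.Prime] (hk : k ≠ 0) (n : ℤ) :
    IsUnit (n : ZMod (p ^ k)) ↔ (n : ZMod p) ≠ 0 := by
  rw [ZMod.coe_int_isUnit_iff_isCoprime, Nat.cast_pow, IsCoprime.pow_left_iff (Nat.pos_of_ne_zero hk),
    ← ZMod.coe_int_isUnit_iff_isCoprime, isUnit_iff_ne_zero]

theorem isUnit_iff_castHom_ne_zero {p k : ℕ} [hp : Fact p.Prime] (hk : k ≠ 0)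
    (x : ZMod (p ^ k)) :
    IsUnit x ↔ ZMod.castHom (dvd_pow_self p hk) (ZMod p) x ≠ 0 := by
  obtain ⟨n, rfl⟩ := ZMod.intCast_surjective x
  rw [isUnit_intCast_prime_pow hk, map_intCast]

theorem exists_root_lift {p : ℕ} [Fact p.Prime] {t n : ℤ}
    (h : (p : ℤ) ∣ n ^ 2 + t * n + 1) (hn : IsCoprime (2 * n + t) (p : ℤ)) (j : ℕ) :
    ∃ m : ℤ, (p : ℤ) ^ (j + 1) ∣ m ^ 2 + t * m + 1 ∧ IsCoprime (2 * m + t) (p : ℤ) := by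
  induction j with
  | zero => exact ⟨n, by simpa using h, hn⟩
  | succ j ih =>
    obtain ⟨m, ⟨q, hq⟩, u, v, huv⟩ := ih
    -- A Newton step: u inverts the derivative 2m + t modulo p, and p^(j+1) q is the value of the
    -- polynomial at m.
    refine ⟨m - p ^ (j + 1) * q * u, ⟨q * v + p ^ j * q ^ 2 * u ^ 2, ?_⟩, ?_⟩
    · linear_combination hq - (p : ℤ) ^ (j + 1) * q * huv
    · rw [show 2 * (m - p ^ (j + 1) * q * u) + t =
        (2 * m + t) + p * (-(2 * p ^ j * q * u)) by ring]
      exact IsCoprime.add_mul_left_left ⟨u, v, huv⟩ _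

theorem rootCount_prime_pow {p k : ℕ} [hp : Fact p.Prime] (hk : k ≠ 0) {t : ℤ} {r : ZMod p}
    (h : r ^ 2 + t * r + 1 = 0) (hr : 2 * r + t ≠ 0) : rootCount (ZMod (p ^ k)) t = 2 := by
  have := isLocalRing_zmod_prime_pow hp.out hk
  obtain ⟨n, rfl⟩ := ZMod.intCast_surjective r
  have h1 : (p : ℤ) ∣ n ^ 2 + t * n + 1 := by
    rw [← ZMod.intCast_zmod_eq_zero_iff_dvd]
    push_cast
    exact h
  have h2 : IsCoprime (2 * n + t) (p : ℤ) := by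
    rw [isCoprime_comm, ← ZMod.coe_int_isUnit_iff_isCoprime, isUnit_iff_ne_zero]
    push_cast
    exact hr
  obtain ⟨m, hm, hm'⟩ := exists_root_lift h1 h2 (k - 1)
  rw [Nat.sub_add_cancel (Nat.pos_of_ne_zero hk)] at hm
  refine rootCount_eq_two (r := (m : ZMod (p ^ k))) ?_ ?_
  · have := (ZMod.intCast_zmod_eq_zero_iff_dvd (m ^ 2 + t * m + 1) (p ^ k)).2 (by exact_mod_cast hm)
    push_cast at this
    exact this
  · have := (ZMod.coe_int_isUnit_iff_isCoprime (2 * m + t) (p ^ k)).2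
      (by rw [Nat.cast_pow]; exact hm'.symm.pow_left)
    push_cast at this
    exact this

theorem rootCount_prime_pow_eq_zero {p k : ℕ} [hp : Fact p.Prime] (hk : k ≠ 0) {t : ℤ}
    (h : ∀ r : ZMod p, r ^ 2 + t * r + 1 = 0 → 2 * r + t = 0) :
    rootCount (ZMod (p ^ k)) t = 0 := by
  rw [rootCount, Nat.card_eq_zero]
  left
  refine ⟨fun ⟨r, hr, hu⟩ => ?_⟩
  rw [isUnit_iff_castHom_ne_zero hk, map_add, map_mul, map_ofNat, map_intCast] at hu
  refine hu (h _ ?_)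
  have := congrArg (ZMod.castHom (dvd_pow_self p hk) (ZMod p)) hr
  rw [map_add, map_add, map_mul, map_pow, map_intCast, map_one, map_zero] at this
  exact this

theorem card_subtype_comp {R S : Type*} [Ring R] [Ring S] (f : R →+* S)
    (hf : Function.Surjective f) (P : S → Prop) :
    Nat.card {x // P (f x)} = Nat.card {y // P y} * Nat.card (RingHom.ker f) := by
  obtain ⟨σ, hσ⟩ := hf.hasRightInverse
  rw [← Nat.card_prod]
  symm
  have hmem : ∀ x : {y // P y} × RingHom.ker f, P (f (σ x.1 + x.2)) := by
    rintro ⟨⟨y, hy⟩, z, hz⟩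
    rw [map_add, hσ, (RingHom.mem_ker).1 hz, add_zero]
    exact hy
  refine Nat.card_eq_of_bijective (fun x => ⟨_, hmem x⟩) ⟨?_, ?_⟩
  · rintro ⟨⟨y, hy⟩, z, hz⟩ ⟨⟨y', hy'⟩, z', hz'⟩ h
    have h1 : σ y + z = σ y' + z' := Subtype.ext_iff.1 h
    obtain rfl : y = y' := by
      have := congrArg f h1
      rwa [map_add, map_add, hσ, hσ, (RingHom.mem_ker).1 hz, (RingHom.mem_ker).1 hz', add_zero,
        add_zero] at this
    obtain rfl : z = z' := add_left_cancel h1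
    rfl
  · rintro ⟨x, hx⟩
    refine ⟨(⟨f x, hx⟩, ⟨x - σ (f x), ?_⟩), Subtype.ext (add_sub_cancel _ _)⟩
    rw [RingHom.mem_ker, map_sub, hσ, sub_self]

theorem card_isUnit_sq_add_one {p k : ℕ} [hp : Fact p.Prime] (hk : k ≠ 0) :
    Nat.card {s : ZMod (p ^ k) // IsUnit (s ^ 2 + 1)} =
      p ^ (k - 1) * (p - Nat.card {s : ZMod p // s ^ 2 + 1 = 0}) := by
  set f := ZMod.castHom (dvd_pow_self p hk) (ZMod p) with hf
  have hsurj : Function.Surjective f := ZMod.castHom_surjective _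
  have hker : Nat.card (RingHom.ker f) = p ^ (k - 1) := by
    have h := card_subtype_comp f hsurj (fun _ => True)
    simp only [Nat.card_congr (Equiv.subtypeUnivEquiv fun _ => trivial), Nat.card_zmod] at h
    refine Nat.eq_of_mul_eq_mul_left hp.out.pos ?_
    rw [← h, mul_pow_sub_one hk]
  have hcompl : Nat.card {s : ZMod p // s ^ 2 + 1 ≠ 0} =
      p - Nat.card {s : ZMod p // s ^ 2 + 1 = 0} := by
    conv_rhs => enter [1]; rw [← ZMod.card p]
    simp only [Nat.card_eq_fintype_card]
    exact Fintype.card_subtype_compl _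
  rw [← hcompl, mul_comm, ← hker, ← card_subtype_comp f hsurj (fun s => s ^ 2 + 1 ≠ 0)]
  refine Nat.card_congr (Equiv.subtypeEquivRight fun s => ?_)
  rw [isUnit_iff_castHom_ne_zero hk, map_add, map_pow, map_one]

theorem card_units_prime_pow {p k : ℕ} (hp : p.Prime) (hk : k ≠ 0) :
    Nat.card (ZMod (p ^ k))ˣ = p ^ (k - 1) * (p - 1) := by
  have : NeZero (p ^ k) := ⟨(pow_pos hp.pos k).ne'⟩
  rw [Nat.card_eq_fintype_card, ZMod.card_units_eq_totient,
    Nat.totient_prime_pow hp (Nat.pos_of_ne_zero hk)]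

theorem exists_sq_add_one {p : ℕ} [hp : Fact p.Prime] (h4 : p % 4 = 1) :
    ∃ r : ZMod p, r ^ 2 + 1 = 0 := by
  obtain ⟨r, hr⟩ := ZMod.exists_sq_eq_neg_one_iff.2 (show p % 4 ≠ 3 by omega)
  exact ⟨r, by rw [pow_two, ← hr, neg_add_cancel]⟩

theorem sq_add_one_ne_zero {p : ℕ} [hp : Fact p.Prime] (h4 : p % 4 = 3) (r : ZMod p) :
    r ^ 2 + 1 ≠ 0 := fun h =>
  ZMod.exists_sq_eq_neg_one_iff.1 ⟨r, by rw [← pow_two]; linear_combination -h⟩ h4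

theorem two_ne_zero_zmod {p : ℕ} [hp : Fact p.Prime] (h2 : p ≠ 2) : (2 : ZMod p) ≠ 0 := by
  intro h
  have : ((2 : ℕ) : ZMod p) = 0 := by exact_mod_cast h
  rw [ZMod.natCast_eq_zero_iff] at this
  exact h2 ((Nat.prime_dvd_prime_iff_eq hp.out Nat.prime_two).1 this)

theorem two_mul_ne_zero {p : ℕ} [hp : Fact p.Prime] (h2 : p ≠ 2) {r : ZMod p}
    (hr : r ^ 2 + 1 = 0) : 2 * r ≠ 0 := by
  refine mul_ne_zero (two_ne_zero_zmod h2) ?_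
  rintro rfl
  simp at hr

theorem rootCount_zero {p k : ℕ} [hp : Fact p.Prime] (hk : k ≠ 0) :
    rootCount (ZMod (p ^ k)) 0 = if p % 4 = 1 then 2 else 0 := by
  split_ifs with h4
  · obtain ⟨r, hr⟩ := exists_sq_add_one h4
    refine rootCount_prime_pow hk (r := r) (by simpa using hr) ?_
    simpa using two_mul_ne_zero (by omega) hr
  · refine rootCount_prime_pow_eq_zero hk fun r hr => ?_
    -- Modulo 2 there is a root, but the derivative 2r vanishes, so it is not simple.
    rcases eq_or_ne p 2 with rfl | h2
    · have : (2 : ZMod 2) = 0 := rfl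
      simp [this]
    · have := hp.out.eq_two_or_odd
      exact absurd (by simpa using hr) (sq_add_one_ne_zero (by omega) r)

theorem card_sq_add_one {p : ℕ} [hp : Fact p.Prime] :
    Nat.card {s : ZMod p // s ^ 2 + 1 = 0} =
      if p % 4 = 1 then 2 else if p % 4 = 3 then 0 else 1 := by
  split_ifs with h1 h3
  · obtain ⟨r, hr⟩ := exists_sq_add_one h1
    refine Eq.trans ?_ (rootCount_eq_two (R := ZMod p) (t := 0) (r := r) (by simpa using hr)
      (by simpa using two_mul_ne_zero (by omega) hr))
    refine Nat.card_congr (Equiv.subtypeEquivRight fun s => ?_)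
    simp only [Int.cast_zero, zero_mul, add_zero]
    exact ⟨fun h => ⟨h, (two_mul_ne_zero (by omega) h).isUnit⟩, fun h => h.1⟩
  · rw [Nat.card_eq_zero]
    exact Or.inl ⟨fun s => sq_add_one_ne_zero h3 s.1 s.2⟩
  · have := hp.out.eq_two_or_odd
    obtain rfl : p = 2 := by omega
    rw [Nat.card_eq_fintype_card]
    rfl

/-- Simple roots of r² + r + 1 modulo p are the elements of order 3; for p = 3 the only root, 1, is
double. -/
theorem rootCount_one {p k : ℕ} [hp : Fact p.Prime] (hk : k ≠ 0) :
    rootCount (ZMod (p ^ k)) 1 = if p % 3 = 1 then 2 else 0 := by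
  split_ifs with h3
  · have : Fact (Nat.Prime 3) := ⟨Nat.prime_three⟩
    obtain ⟨g, hg⟩ := exists_prime_orderOf_dvd_card (G := (ZMod p)ˣ) 3
      (by rw [ZMod.card_units]; omega)
    have hg3 : (g : ZMod p) ^ 3 = 1 := by
      rw [← Units.val_pow_eq_pow_val, ← hg, pow_orderOf_eq_one, Units.val_one]
    have hg1 : (g : ZMod p) - 1 ≠ 0 := fun h => by
      have : g = 1 := Units.ext (sub_eq_zero.1 h)
      rw [this, orderOf_one] at hg
      omega
    have hroot : (g : ZMod p) ^ 2 + g + 1 = 0 := by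
      refine (mul_eq_zero.1 (?_ : ((g : ZMod p) - 1) * _ = 0)).resolve_left hg1
      linear_combination hg3
    refine rootCount_prime_pow hk (r := (g : ZMod p)) (by simpa using hroot) fun h => ?_
    -- The discriminant: 3 = 4(r² + r + 1) − (2r + 1)².
    have h3' : ((3 : ℕ) : ZMod p) = 0 := by
      push_cast at h ⊢
      linear_combination 4 * hroot - (2 * (g : ZMod p) + 1) * h
    rw [ZMod.natCast_eq_zero_iff, Nat.prime_dvd_prime_iff_eq hp.out Nat.prime_three] at h3'
    omega
  · refine rootCount_prime_pow_eq_zero hk fun r hr => ?_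
    push_cast at hr ⊢
    by_contra hne
    have hr3 : r ^ 3 = 1 := by linear_combination (r - 1) * hr
    have hr1 : r ≠ 1 := by
      rintro rfl
      refine hne ?_
      linear_combination hr
    have hord : orderOf r = 3 := by
      have : Fact (Nat.Prime 3) := ⟨Nat.prime_three⟩
      exact orderOf_eq_prime hr3 hr1
    have hr0 : r ≠ 0 := by
      rintro rfl
      simp at hr
    have hdvd : 3 ∣ p - 1 := by
      rw [← hord]
      exact orderOf_dvd_of_pow_eq_one (ZMod.pow_card_sub_one_eq_one hr0)
    have := hp.out.two_le
    omega

theorem conjCount_one_div {p k : ℕ} [hp : Fact p.Prime] (hk : k ≠ 0) :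
    (conjCount (ZMod (p ^ k)) (ellipticMatrix 1) : ℚ) / monoCount (ZMod (p ^ k)) =
      if p % 3 = 1 then 1 else 0 := by
  have := isLocalRing_zmod_prime_pow hp.out hk
  have : NeZero (p ^ k) := ⟨(pow_pos hp.out.pos k).ne'⟩
  have hpos : (Nat.card (ZMod (p ^ k))ˣ : ℚ) ≠ 0 := by exact_mod_cast Nat.card_pos.ne'
  rw [conjCount_ellipticMatrix_one, monoCount_eq, rootCount_one hk]
  split_ifs
  · push_cast
    field_simp
  · simp

theorem conjCount_zero_div {p k : ℕ} [hp : Fact p.Prime] (hk : k ≠ 0) :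
    (conjCount (ZMod (p ^ k)) (ellipticMatrix 0) : ℚ) / monoCount (ZMod (p ^ k)) =
      if p % 4 = 1 then 1 + (p : ℚ) ^ (k - 1) * ((p : ℚ) - 1) / 2
      else if p % 4 = 3 then (p : ℚ) ^ (k - 1) * ((p : ℚ) + 1) / 2
      else (2 : ℚ) ^ (k - 1) := by
  have := isLocalRing_zmod_prime_pow hp.out hk
  have : NeZero (p ^ k) := ⟨(pow_pos hp.out.pos k).ne'⟩
  have hpos : (Nat.card (ZMod (p ^ k))ˣ : ℚ) ≠ 0 := by exact_mod_cast Nat.card_pos.ne'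
  have h2p := hp.out.two_le
  have hsub : p ^ k - p ^ (k - 1) * (p - 1) = p ^ (k - 1) := by
    rw [← mul_pow_sub_one hk p]
    obtain ⟨q, rfl⟩ := Nat.exists_eq_add_of_le' hp.out.one_le
    rw [Nat.add_sub_cancel, Nat.sub_eq_iff_eq_add' (by nlinarith [Nat.zero_le ((q + 1) ^ (k - 1))])]
    ring
  rw [conjCount_ellipticMatrix_zero, monoCount_eq, rootCount_zero hk,
    card_isUnit_sq_add_one hk, card_sq_add_one, Nat.card_zmod]
  -- Only the unit count inside the number of nonunits is made explicit; the others cancel against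
  -- `monoCount`.
  nth_rw 2 [card_units_prime_pow hp.out hk]
  rw [hsub]
  split_ifs with h1 h3
  · push_cast [Nat.cast_sub h2p]
    field_simp
    ring
  · rw [Nat.sub_zero]
    push_cast
    field_simp
    ring
  · have := hp.out.eq_two_or_odd
    obtain rfl : p = 2 := by omega
    push_cast
    field_simp
    ring

end PrimePower

/-! ### Cusps -/

section Cusps

theorem map_T_pow (R : Type*) [CommRing R] (k : ℕ) :
    (Matrix.SpecialLinearGroup.map (Int.castRingHom R) (ModularGroup.T ^ k)).1 =
      !![1, (k : R); 0, 1] := by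
  rw [Matrix.SpecialLinearGroup.map_apply_coe, ← zpow_natCast, ModularGroup.coe_T_zpow]
  ext i j
  fin_cases i <;> fin_cases j <;> simp

theorem map_T_pow_eq_one_iff {R : Type*} [CommRing R] (k : ℕ) :
    Matrix.SpecialLinearGroup.map (Int.castRingHom R) (ModularGroup.T ^ k) = 1 ↔ (k : R) = 0 := by
  have h := map_T_pow R k
  constructor
  · intro H
    rw [H, Matrix.SpecialLinearGroup.coe_one] at h
    simpa using (congrFun (congrFun h 0) 1).symm
  · intro H
    refine Subtype.ext ?_
    rw [h, H, Matrix.SpecialLinearGroup.coe_one, Matrix.one_fin_two]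

theorem orderOf_map_T (N : ℕ) :
    orderOf (Matrix.SpecialLinearGroup.map (Int.castRingHom (ZMod N)) ModularGroup.T) = N := by
  refine Nat.dvd_antisymm (orderOf_dvd_of_pow_eq_one ?_) ?_
  · rw [← map_pow, map_T_pow_eq_one_iff, ZMod.natCast_self]
  · rw [← ZMod.natCast_eq_zero_iff, ← map_T_pow_eq_one_iff, map_pow, pow_orderOf_eq_one]

/-- A monomial conjugate of `(1 k; 0 1)` forces `2k = 0`, and `k = 0` if moreover `k² = 0`. -/
theorem IsMono.conj_T_pow {R : Type*} [CommRing R] {k : ℕ} {g : SL(2, R)}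
    (hg : IsMono (g * Matrix.SpecialLinearGroup.map (Int.castRingHom R) (ModularGroup.T ^ k) *
      g⁻¹)) : 2 * (k : R) = 0 ∧ ((k : R) ^ 2 = 0 → (k : R) = 0) := by
  obtain ⟨a, b, c, d, h, rfl⟩ := exists_slMk g
  rw [IsMono, Matrix.SpecialLinearGroup.coe_mul, Matrix.SpecialLinearGroup.coe_mul,
    Matrix.SpecialLinearGroup.coe_inv, map_T_pow, coe_slMk, Matrix.adjugate_fin_two_of,
    Matrix.mul_fin_two, Matrix.mul_fin_two] at hg
  simp only [Matrix.of_apply, Matrix.cons_val', Matrix.cons_val_zero,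
    Matrix.cons_val_one, Matrix.cons_val_fin_one] at hg
  generalize (k : R) = x at hg ⊢
  obtain ⟨h1, h2⟩ := hg
  have e1 : x * a ^ 2 * (1 - x * a * c) = 0 := by
    have h00 : (a * 1 + b * 0) * d + (a * x + b * 1) * -c = 1 - x * a * c := by
      linear_combination h
    rw [h00] at h1
    linear_combination h1
  have e2 : x * c ^ 2 * (1 + x * a * c) = 0 := by
    have h11 : (c * 1 + d * 0) * -b + (c * x + d * 1) * a = 1 + x * a * c := by
      linear_combination h
    rw [h11] at h2
    linear_combination -h2
  -- Every term in the expansion of (ad − bc)³ = 1 is divisible by a² or c², so `e1` and `e2`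
  -- together kill x(1 − (xac)²).
  have e3 : x = x * (x * a * c) ^ 2 := by
    have hb : (a * d - b * c) ^ 3 = 1 := by rw [h, one_pow]
    linear_combination (a * d ^ 3 - 3 * b * c * d ^ 2) * (1 + x * a * c) * e1 +
      (3 * a * b ^ 2 * d - b ^ 3 * c) * (1 - x * a * c) * e2 -
      x * (1 - (x * a * c) ^ 2) * hb
  refine ⟨?_, fun hx => ?_⟩
  · have e4 : 2 * (x * a * c) ^ 3 = 0 := by
      linear_combination x * a ^ 2 * e2 - x * c ^ 2 * e1
    linear_combination 2 * (1 + (x * a * c) ^ 2) * e3 + x * (x * a * c) * e4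
  · linear_combination e3 + x * a ^ 2 * c ^ 2 * hx

theorem conjCount_T_pow_eq_zero {R : Type*} [CommRing R] {k : ℕ}
    (h : 2 * (k : R) = 0 → (k : R) ^ 2 = 0 ∧ (k : R) ≠ 0) :
    conjCount R (ModularGroup.T ^ k) = 0 := by
  rw [conjCount, Nat.card_eq_zero]
  refine Or.inl ⟨fun ⟨g, hg⟩ => ?_⟩
  obtain ⟨h1, h2⟩ := hg.conj_T_pow
  exact (h h1).2 (h2 (h h1).1)

theorem conjCount_of_map_eq {R : Type*} [CommRing R] {x y : SL(2, ℤ)}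
    (h : Matrix.SpecialLinearGroup.map (Int.castRingHom R) x =
      Matrix.SpecialLinearGroup.map (Int.castRingHom R) y) : conjCount R x = conjCount R y := by
  rw [conjCount, conjCount, h]

theorem conjCount_T_pow_of_eq_zero {R : Type*} [CommRing R] {k : ℕ} (h : (k : R) = 0) :
    conjCount R (ModularGroup.T ^ k) = conjCount R 1 :=
  conjCount_of_map_eq (by rw [(map_T_pow_eq_one_iff k).2 h, map_one])

theorem conjCount_zmod_two_one : conjCount (ZMod 2) 1 = 6 := by
  have := isLocalRing_zmod_prime_pow Nat.prime_two one_ne_zero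
  rw [pow_one] at this
  rw [conjCount_one, card_specialLinear_two, Nat.card_zmod, Nat.card_eq_fintype_card,
    ZMod.card_units]

theorem conjCount_zmod_two_T : conjCount (ZMod 2) ModularGroup.T = 2 := by
  classical
  have : ∀ g : SL(2, ZMod 2), IsMono (g * Matrix.SpecialLinearGroup.map (Int.castRingHom (ZMod 2))
      ModularGroup.T * g⁻¹) ↔ g.1 0 0 = 1 ∧ g.1 1 0 = 1 := by
    intro g
    obtain ⟨a, b, c, d, h, rfl⟩ := exists_slMk g
    have hT := map_T_pow (ZMod 2) 1
    rw [pow_one, Nat.cast_one] at hT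
    rw [IsMono, Matrix.SpecialLinearGroup.coe_mul, Matrix.SpecialLinearGroup.coe_mul,
      Matrix.SpecialLinearGroup.coe_inv, hT, coe_slMk, Matrix.adjugate_fin_two_of,
      Matrix.mul_fin_two, Matrix.mul_fin_two]
    simp only [Matrix.of_apply, Matrix.cons_val', Matrix.cons_val_zero,
      Matrix.cons_val_one, Matrix.cons_val_fin_one]
    revert a b c d
    decide
  rw [conjCount, Nat.card_congr (Equiv.subtypeEquivRight this), Nat.card_eq_fintype_card]
  decide

/-- T^m is trivial modulo m and equals T modulo 2, where 2 of the 6 elements of SL₂(𝔽₂) conjugate T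
to a monomial matrix. -/
theorem three_mul_conjCount_T_pow {m : ℕ} (hm : Odd m) :
    3 * conjCount (ZMod (2 * m)) (ModularGroup.T ^ m) = conjCount (ZMod (2 * m)) 1 := by
  have e := ZMod.chineseRemainder (Nat.coprime_two_left.2 hm)
  rw [conjCount_prod e, conjCount_prod e, conjCount_T_pow_of_eq_zero (ZMod.natCast_self m),
    conjCount_zmod_two_one]
  have h2 : conjCount (ZMod 2) (ModularGroup.T ^ m) = 2 := by
    refine (conjCount_of_map_eq (Subtype.ext ?_)).trans conjCount_zmod_two_T
    conv_rhs => rw [← pow_one ModularGroup.T]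
    rw [map_T_pow, map_T_pow, ZMod.natCast_eq_one_iff_odd.2 hm, Nat.cast_one]
  rw [h2]
  ring

/-- A nonzero term needs k = 0 or k = N/2. If N/2 is even, its square is 0 modulo N, which excludes
it. -/
theorem sum_conjCount_T_pow {N : ℕ} (hN : N ≠ 0) :
    ∑ k ∈ Finset.range N, (conjCount (ZMod N) (ModularGroup.T ^ k) : ℚ) =
      (if 2 ∣ N ∧ ¬ 4 ∣ N then 4 / 3 else 1) * conjCount (ZMod N) 1 := by
  have hzero : ∀ k ∈ Finset.range N, k ≠ 0 → ¬ (2 * k = N ∧ Odd k) →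
      conjCount (ZMod N) (ModularGroup.T ^ k) = 0 := by
    intro k hk hk0 hodd
    rw [Finset.mem_range] at hk
    refine conjCount_T_pow_eq_zero fun h => ?_
    have h1 : N ∣ 2 * k := by
      rw [← ZMod.natCast_eq_zero_iff]
      exact_mod_cast h
    obtain ⟨q, hq⟩ := h1
    have hq1 : q = 1 := by
      have : q < 2 := by
        by_contra hc
        nlinarith
      have : q ≠ 0 := by
        rintro rfl
        omega
      omega
    rw [hq1, mul_one] at hq
    have heven : Even k := by
      rw [← Nat.not_odd_iff_even]
      exact fun ho => hodd ⟨hq, ho⟩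
    obtain ⟨l, hl⟩ := heven
    refine ⟨?_, ?_⟩
    · rw [← Nat.cast_pow, ZMod.natCast_eq_zero_iff, ← hq]
      exact ⟨l, by rw [hl]; ring⟩
    · rw [Ne, ZMod.natCast_eq_zero_iff]
      exact Nat.not_dvd_of_pos_of_lt (Nat.pos_of_ne_zero hk0) hk
  split_ifs with h
  · obtain ⟨⟨m, rfl⟩, h4⟩ := h
    have hm : Odd m := by
      rw [← Nat.not_even_iff_odd]
      rintro ⟨l, rfl⟩
      exact h4 ⟨l, by ring⟩
    have hm0 : m ≠ 0 := by omega
    rw [← Finset.sum_subset (s₁ := {0, m}), Finset.sum_pair hm0.symm, pow_zero,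
      ← three_mul_conjCount_T_pow hm]
    · push_cast
      ring
    · intro k hk
      rw [Finset.mem_insert, Finset.mem_singleton] at hk
      rw [Finset.mem_range]
      omega
    · intro k hk hk'
      rw [Finset.mem_insert, Finset.mem_singleton, not_or] at hk'
      rw [hzero k hk hk'.1 (by rintro ⟨h1, -⟩; omega), Nat.cast_zero]
  · rw [Finset.sum_eq_single 0, pow_zero, one_mul]
    · intro k hk hk0
      rw [hzero k hk hk0, Nat.cast_zero]
      rintro ⟨rfl, l, rfl⟩
      exact h ⟨⟨_, rfl⟩, by omega⟩
    · intro h0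
      exact absurd (Finset.mem_range.2 (Nat.pos_of_ne_zero hN)) h0

/-- This ratio is the index of Γ in SL₂(ℤ/N); Burnside's lemma then divides it by the order N of T.
-/
theorem conjCount_one_div_monoCount {N : ℕ} (hN : N ≠ 0) :
    (conjCount (ZMod N) 1 : ℚ) / monoCount (ZMod N) =
      (N : ℚ) ^ 2 / 2 ^ N.primeFactors.card * ∏ p ∈ N.primeFactors, (1 + 1 / (p : ℚ)) := by
  have hloc : ∀ p ∈ N.primeFactors, (conjCount (ZMod (p ^ N.factorization p)) 1 : ℚ) /
      monoCount (ZMod (p ^ N.factorization p)) =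
      ((p : ℚ) ^ N.factorization p) ^ 2 / 2 * (1 + 1 / p) := by
    intro p hp
    have hpp := Nat.prime_of_mem_primeFactors hp
    have : Fact p.Prime := ⟨hpp⟩
    have hk : N.factorization p ≠ 0 :=
      (hpp.factorization_pos_of_dvd hN (Nat.dvd_of_mem_primeFactors hp)).ne'
    generalize N.factorization p = k at hk
    have := isLocalRing_zmod_prime_pow hpp hk
    have : NeZero (p ^ k) := ⟨(pow_pos hpp.pos k).ne'⟩
    obtain ⟨j, rfl⟩ := Nat.exists_eq_succ_of_ne_zero hk
    have hp0 : (p : ℚ) ≠ 0 := by exact_mod_cast hpp.ne_zero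
    have hp1 : (p : ℚ) - 1 ≠ 0 := sub_ne_zero.2 (by exact_mod_cast hpp.one_lt.ne')
    rw [conjCount_one, card_specialLinear_two, monoCount_eq, card_units_prime_pow hpp hk,
      Nat.card_zmod, Nat.succ_eq_add_one, Nat.add_sub_cancel,
      show p ^ (j + 1) - p ^ j * (p - 1) = p ^ j by
        rw [pow_succ, ← Nat.mul_sub, Nat.sub_sub_self hpp.one_le, mul_one]]
    push_cast [Nat.cast_sub hpp.one_le]
    field_simp
    ring
  have hNprod : (N : ℚ) = ∏ p ∈ N.primeFactors, (p : ℚ) ^ N.factorization p := by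
    conv_lhs => rw [← Nat.prod_factorization_pow_eq_self hN]
    rw [Finsupp.prod, Nat.support_factorization]
    push_cast
    rfl
  rw [conjCount_div_monoCount 1 hN, Finset.prod_congr rfl hloc, Finset.prod_mul_distrib,
    Finset.prod_div_distrib, Finset.prod_const, Finset.prod_pow, ← hNprod]

theorem cusps_cartanStar {N : ℕ} (hN : N ≠ 0) :
    (cusps (cartanStar N) : ℚ) = (if 2 ∣ N ∧ ¬ 4 ∣ N then 4 / 3 else 1) *
      ((N : ℚ) / 2 ^ N.primeFactors.card * ∏ p ∈ N.primeFactors, (1 + 1 / (p : ℚ))) := by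
  have : NeZero N := ⟨hN⟩
  set x := Matrix.SpecialLinearGroup.map (Int.castRingHom (ZMod N)) ModularGroup.T with hx
  have hT : cusps (cartanStar N) = cosetOrbits (slPart (cartanStar N)) x := by
    rw [cusps]
    congr 1
    refine Subtype.ext ?_
    have := map_T_pow (ZMod N) 1
    rw [pow_one, Nat.cast_one] at this
    exact this.symm
  have hb := cosetOrbits_mul (slPart (cartanStar N)) x
  rw [orderOf_map_T, card_slPart_cartanStar, ← hT] at hb
  have hsum : ∑ k ∈ Finset.range N, Nat.card {g // g * x ^ k * g⁻¹ ∈ slPart (cartanStar N)} =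
      ∑ k ∈ Finset.range N, conjCount (ZMod N) (ModularGroup.T ^ k) := by
    refine Finset.sum_congr rfl fun k _ => ?_
    refine Nat.card_congr (Equiv.subtypeEquivRight fun g => ?_)
    rw [mem_slPart_cartanStar, hx, map_pow]
  rw [hsum] at hb
  have hb' : (cusps (cartanStar N) : ℚ) * N * monoCount (ZMod N) = _ :=
    (by exact_mod_cast hb : _ = ((∑ k ∈ Finset.range N,
      (conjCount (ZMod N) (ModularGroup.T ^ k)) : ℕ) : ℚ))
  rw [Nat.cast_sum, sum_conjCount_T_pow hN] at hb'
  have hm : (monoCount (ZMod N) : ℚ) ≠ 0 := by exact_mod_cast (monoCount_pos _).ne'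
  have hN' : (N : ℚ) ≠ 0 := by exact_mod_cast hN
  have h1 := conjCount_one_div_monoCount hN
  rw [div_eq_iff hm] at h1
  rw [h1] at hb'
  refine mul_right_cancel₀ hm (mul_right_cancel₀ hN' ?_)
  linear_combination hb'

end Cusps

/-! ### Elliptic points -/

section Elliptic

theorem map_ellipticMatrix (R : Type*) [CommRing R] (t : ℤ) :
    (Matrix.SpecialLinearGroup.map (Int.castRingHom R) (ellipticMatrix t)).1 =
      !![0, -1; 1, -(t : R)] := by
  rw [Matrix.SpecialLinearGroup.map_apply_coe, coe_ellipticMatrix]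
  ext i j
  fin_cases i <;> fin_cases j <;> simp

theorem ellipticThree_cartanStar {N : ℕ} (hN : N ≠ 0) :
    ellipticThree (cartanStar N) = if ∀ p ∈ N.primeFactors, p % 3 = 1 then 1 else 0 := by
  have : NeZero N := ⟨hN⟩
  have h : (ellipticThree (cartanStar N) : ℚ) =
      ∏ p ∈ N.primeFactors, if p % 3 = 1 then 1 else 0 := by
    have hx : ellipticThree (cartanStar N) = fixedCosets (slPart (cartanStar N))
        (Matrix.SpecialLinearGroup.map (Int.castRingHom _) (ellipticMatrix 1)) := by
      rw [ellipticThree]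
      congr 1
      refine Subtype.ext ?_
      rw [map_ellipticMatrix, Int.cast_one]
    rw [hx, fixedCosets_eq_prod]
    refine Finset.prod_congr rfl fun p hp => ?_
    have hpp := Nat.prime_of_mem_primeFactors hp
    have : Fact p.Prime := ⟨hpp⟩
    exact conjCount_one_div
      (hpp.factorization_pos_of_dvd hN (Nat.dvd_of_mem_primeFactors hp)).ne'
  rw [Finset.prod_ite_zero, Finset.prod_const_one] at h
  split_ifs at h ⊢ <;> exact_mod_cast h

theorem ellipticTwo_cartanStar {N : ℕ} (hN : N ≠ 0) :
    (ellipticTwo (cartanStar N) : ℚ) =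
      (if 2 ∣ N then (2 : ℚ) ^ (padicValNat 2 N - 1) else 1) *
        (∏ p ∈ N.primeFactors with p % 4 = 1,
          (1 + (p : ℚ) ^ (padicValNat p N - 1) * ((p : ℚ) - 1) / 2)) *
        ∏ p ∈ N.primeFactors with p % 4 = 3,
          ((p : ℚ) ^ (padicValNat p N - 1) * ((p : ℚ) + 1) / 2) := by
  have : NeZero N := ⟨hN⟩
  have hx : ellipticTwo (cartanStar N) = fixedCosets (slPart (cartanStar N))
      (Matrix.SpecialLinearGroup.map (Int.castRingHom _) (ellipticMatrix 0)) := by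
    rw [ellipticTwo]
    congr 1
    refine Subtype.ext ?_
    rw [map_ellipticMatrix, Int.cast_zero, neg_zero]
  -- The factor c(N) is spread over all primes dividing N, so that the three products can be
  -- compared factor by factor.
  have h2 : (if 2 ∣ N then (2 : ℚ) ^ (padicValNat 2 N - 1) else 1) =
      ∏ p ∈ N.primeFactors, if p = 2 then (2 : ℚ) ^ (padicValNat 2 N - 1) else 1 := by
    rw [Finset.prod_ite_eq']
    simp [Nat.prime_two, hN]
  rw [hx, fixedCosets_eq_prod, h2, Finset.prod_filter, Finset.prod_filter,
    ← Finset.prod_mul_distrib, ← Finset.prod_mul_distrib]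
  refine Finset.prod_congr rfl fun p hp => ?_
  have hpp := Nat.prime_of_mem_primeFactors hp
  have : Fact p.Prime := ⟨hpp⟩
  rw [conjCount_zero_div
    (hpp.factorization_pos_of_dvd hN (Nat.dvd_of_mem_primeFactors hp)).ne',
    Nat.factorization_def N hpp]
  rcases hpp.eq_two_or_odd with rfl | hodd
  · simp
  · have hne : p ≠ 2 := by
      rintro rfl
      omega
    have h13 : p % 4 = 1 ∨ p % 4 = 3 := by omega
    rcases h13 with h | h <;> simp [h, hne]

end Elliptic

end SplitCartan

theorem corollary3p5 (N : ℕ) (hN : 1 ≤ N) :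
    (SplitCartan.cusps (SplitCartan.cartanStar N) : ℚ) =
        (if 2 ∣ N ∧ ¬ 4 ∣ N then
          (N : ℚ) / (3 * (2 : ℚ) ^ ((N.primeFactors.card : ℤ) - 2)) *
            ∏ p ∈ N.primeFactors, (1 + 1 / (p : ℚ))
        else
          (N : ℚ) / (2 : ℚ) ^ N.primeFactors.card *
            ∏ p ∈ N.primeFactors, (1 + 1 / (p : ℚ))) ∧
      SplitCartan.ellipticThree (SplitCartan.cartanStar N) =
        (if ∀ p ∈ N.primeFactors, p % 3 = 1 then 1 else 0) ∧
      (SplitCartan.ellipticTwo (SplitCartan.cartanStar N) : ℚ) =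
        (if 2 ∣ N then (2 : ℚ) ^ (padicValNat 2 N - 1) else 1) *
          (∏ p ∈ N.primeFactors with p % 4 = 1,
            (1 + (p : ℚ) ^ (padicValNat p N - 1) * ((p : ℚ) - 1) / 2)) *
          ∏ p ∈ N.primeFactors with p % 4 = 3,
            ((p : ℚ) ^ (padicValNat p N - 1) * ((p : ℚ) + 1) / 2) := by
  have hN0 : N ≠ 0 := Nat.one_le_iff_ne_zero.1 hN
  refine ⟨?_, SplitCartan.ellipticThree_cartanStar hN0, SplitCartan.ellipticTwo_cartanStar hN0⟩
  rw [SplitCartan.cusps_cartanStar hN0]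
  split_ifs
  -- The exponent ω(N) − 2 is an integer and may be −1; here 4/3 · 2^(−ω) = 1/(3 · 2^(ω−2)).
  · rw [zpow_sub₀ two_ne_zero, zpow_natCast]
    field_simp
    norm_num
  · rw [one_mul]
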